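/- Let $q$ be a prime power, $r$ a positive divisor of $q-1$, and $p$ a prime with $p\mid q-1$ and $p\nmid (q-1)/r$. For an integer $b\ge 2$ put $n=\Phi_{p^b}(q)=\frac{q^{p^b}-1}{q^{p^{b-1}}-1}$, where $\Phi_{p^b}$ is the $p^b$-th cyclotomic polynomial; $n$ strictly increases with $b$. Let $Z_{n,r}=\{1+ir:0\le i\le n-1\}$. For $i\in Z_{n,r}$ let the coset of $i$ be $\{iq^j \bmod nr: j\ge 0\}$, with residues modulo $nr$ taken in $\{1,\dots,nr\}$; its least element is its leader. For $l\ge1$ let $N_l$ be the number of these cosets that have exactly $l$ elements. Then the set of sizes of the cosets is $\{p,p^b\}$, with $N_p=1$ and $N_{p^b}=(n-p)/p^b$. Elements $\lambda\in\mathbb F_q^*$ of multiplicative order $r$ exist; let $\lambda$ be any of them. There is a primitive $nr$-th root of unity $\beta$ in an algebraic closure of $\mathbb F_q$ with $\beta^n=\lambda$; let $\beta$ be any such root. Recall that a $\lambda$-constacyclic code of length $n$ corresponds to an ideal $\langle g\rangle$ of $\mathbb F_q[x]/\langle x^n-\lambda\rangle$ with $g$ a monic divisor of $x^n-\lambda$,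 and that its defining set is $\{i\in Z_{n,r}: g(\beta^i)=0\}$. (a) The $\lambda$-constacyclic code over $\mathbb F_q$ of length $n$ whose defining set is the union, over both coset sizes $l$, of the first $\lceil N_l/2\rceil$ cosets of size $l$ (listed by increasing leaders) exists. It has dimension $n-p-p^b\left\lceil\frac{n-p}{2p^b}\right\rceil$ and minimum distance at least $$\left\lceil \frac{q\lceil (n-p)/(2p^b)\rceil}{q-1}\right\rceil+\Lambda_{p^b},\qquad \Lambda_{p^b}=\left\lceil\frac{q|S|}{q-1}\right\rceil-1,$$ where, with $m=p^b$ and $s=(q^{p^{b-1}}-1)/r$ (so that $nr=(q^m-1)/s$), $S$ is the set of all triples of integers $(i,j,t)$ such that $$\frac{m+1}{2}\le i\le \lfloor m-\log_q(s+1)\rfloor,\quad 1\le j\le q-1,\quad 0\le t<\frac{q^i-j(q^{m-i}-1)-1}{q^{m-i+1}-q},$$ $$q^i+qt+j\equiv 1 \pmod r,\qquad q^i+qt+j\le 1+\left(\left\lceil \frac{q\lceil N_m/2\rceil}{q-1}\right\rceil-2\right)r .$$ (b) If $r\le 3$ or $2p^{b-1}(q-1)\ge qr$, then the $\lambda$-constacyclic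 code over $\mathbb F_q$ of length $n$ whose defining set is the union, over both coset sizes $l$, of the first $\lfloor N_l/2\rfloor$ cosets of size $l$ exists. It has dimension $n-p^b\left\lfloor\frac{n-p}{2p^b}\right\rfloor$ and minimum distance at least $\left\lfloor \frac{q(n-p)}{2p^b(q-1)}\right\rfloor$. -/

import Mathlib

open Polynomial

/-- The length `n = (q^(p^b) - 1) / (q^(p^(b-1)) - 1)`; the division is exact. -/
def codeLength (p b q : ℕ) : ℕ := (q ^ p ^ b - 1) / (q ^ p ^ (b - 1) - 1)

/-- `Z_{n,r} = {1 + i r : 0 ≤ i ≤ n - 1}`. -/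
def indexSet (n r : ℕ) : Finset ℕ := (Finset.range n).image (fun i => 1 + i * r)

open Classical in
/-- The `q`-cyclotomic coset of `i` modulo `M`, with residues represented in `{1, …, M}`. -/
noncomputable def cyclotomicCoset (q M i : ℕ) : Finset ℕ :=
  (Finset.Icc 1 M).filter (fun k => ∃ j : ℕ, k ≡ i * q ^ j [MOD M])

/-- The set `{l_i : i ∈ Z_{n,r}}` of the sizes of the cosets in `Z_{n,r}`. -/
noncomputable def cosetSizes (q n r : ℕ) : Finset ℕ :=
  (indexSet n r).image (fun i => (cyclotomicCoset q (n * r) i).card)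

/-- `N_l`: the number of cosets with exactly `l` elements in `Z_{n,r}`. -/
noncomputable def numCosets (q n r l : ℕ) : ℕ :=
  (((indexSet n r).image (cyclotomicCoset q (n * r))).filter (fun C => C.card = l)).card

/-- The leaders (least elements) of the cosets with exactly `l` elements in `Z_{n,r}`. -/
noncomputable def cosetLeaders (q n r l : ℕ) : Finset ℕ :=
  (indexSet n r).filter (fun i =>
    (cyclotomicCoset q (n * r) i).card = l ∧ ∀ k ∈ cyclotomicCoset q (n * r) i, i ≤ k)

/-- The union of the first `k` cosets with exactly `l` elements in `Z_{n,r}`, where the cosets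
are listed by increasing leaders. -/
noncomputable def firstCosets (q n r l k : ℕ) : Finset ℕ :=
  ((cosetLeaders q n r l).filter
    (fun i => ((cosetLeaders q n r l).filter (fun j => j < i)).card < k)).biUnion
      (cyclotomicCoset q (n * r))

/-- The union, over all sizes `l`, of the first `⌈N_l / 2⌉` cosets of size `l`. -/
noncomputable def ceilHalf (q n r : ℕ) : Finset ℕ :=
  (cosetSizes q n r).biUnion (fun l => firstCosets q n r l ⌈(numCosets q n r l : ℚ) / 2⌉₊)

/-- The union, over all sizes `l`, of the first `⌊N_l / 2⌋` cosets of size `l`. -/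
noncomputable def floorHalf (q n r : ℕ) : Finset ℕ :=
  (cosetSizes q n r).biUnion (fun l => firstCosets q n r l ⌊(numCosets q n r l : ℚ) / 2⌋₊)

/-- The set `S_m` of triples `(i, j, t)`, for parameters with `n r = (q^m - 1) / s` and `N = N_m`.
The bound on `i` forces `i < m`, so that `m - i` is not truncated. -/
def tripleSet (q m s r N : ℕ) : Set (ℕ × ℕ × ℕ) :=
  {x | match x with
    | (i, j, t) =>
      ((m : ℝ) + 1) / 2 ≤ i ∧ (i : ℤ) ≤ ⌊(m : ℝ) - Real.logb q ((s : ℝ) + 1)⌋ ∧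
      1 ≤ j ∧ j ≤ q - 1 ∧
      (t : ℝ) < ((q : ℝ) ^ i - j * ((q : ℝ) ^ (m - i) - 1) - 1) / ((q : ℝ) ^ (m - i + 1) - q) ∧
      q ^ i + q * t + j ≡ 1 [MOD r] ∧
      ((q ^ i + q * t + j : ℕ) : ℤ) ≤
        1 + (⌈(q : ℚ) * (⌈(N : ℚ) / 2⌉ : ℚ) / ((q : ℚ) - 1)⌉ - 2) * (r : ℤ)}

/-- `Λ_m = ⌈q |S_m| / (q - 1)⌉ - 1`, an integer which is `-1` when `S_m` is empty. -/
noncomputable def lambdaTerm (q m s r N : ℕ) : ℤ :=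
  ⌈(q : ℚ) * ((tripleSet q m s r N).ncard : ℚ) / ((q : ℚ) - 1)⌉ - 1

/-- The polynomial `c_0 + c_1 X + ⋯ + c_{n-1} X^{n-1}` of a word. -/
noncomputable def wordPoly {F : Type*} [Field F] {n : ℕ} (c : Fin n → F) : F[X] :=
  ∑ i : Fin n, Polynomial.C (c i) * X ^ (i : ℕ)

/-- The constacyclic shift `(c_0, …, c_{n-1}) ↦ (lam * c_{n-1}, c_0, …, c_{n-2})`. -/
def constaShift {F : Type*} [Field F] {n : ℕ} (lam : F) (c : Fin n → F) : Fin n → F :=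
  fun i =>
    if (i : ℕ) = 0 then lam * c ⟨n - 1, by have := i.isLt; omega⟩
    else c ⟨(i : ℕ) - 1, by have := i.isLt; omega⟩

/-- `lam`-constacyclic linear codes of length `n`. -/
def IsConstacyclic {F : Type*} [Field F] {n : ℕ} (lam : F) (C : Submodule F (Fin n → F)) : Prop :=
  ∀ c ∈ C, constaShift lam c ∈ C

/-- `g` is the generator polynomial of `C`: it is a monic factor of `X^n - lam`, and `C` is the
ideal generated by `g` in `F[X] / (X^n - lam)`. -/
def IsGeneratorPoly {F : Type*} [Field F] {n : ℕ} (lam : F) (C : Submodule F (Fin n → F))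
    (g : F[X]) : Prop :=
  g.Monic ∧ g ∣ X ^ n - Polynomial.C lam ∧ ∀ c : Fin n → F, c ∈ C ↔ g ∣ wordPoly c

/-- `T` is the defining set of `C` with respect to `β`: `T = {i ∈ Z_{n,r} : g(β^i) = 0}` for the
generator polynomial `g` of `C`. -/
def HasDefiningSet {F : Type*} [Field F] {K : Type*} [Field K] [Algebra F K] {n : ℕ}
    (lam : F) (r : ℕ) (β : K) (C : Submodule F (Fin n → F)) (T : Finset ℕ) : Prop :=
  ∃ g : F[X], IsGeneratorPoly lam C g ∧
    ∀ i : ℕ, i ∈ T ↔ i ∈ indexSet n r ∧ aeval (β ^ i) g = 0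

/-- The minimum Hamming distance between distinct codewords. -/
noncomputable def minDistance {F : Type*} [Field F] [DecidableEq F] {n : ℕ}
    (C : Submodule F (Fin n → F)) : ℕ :=
  sInf {d | ∃ x ∈ C, ∃ y ∈ C, x ≠ y ∧ hammingDist x y = d}

/-! ### Cyclotomic cosets -/

/-! Put `Q = q ^ p ^ (b-1)`, so that `n = 1 + Q + ⋯ + Q^(p-1)`. The hypotheses force `p ∣ r`, and `Q
≡ 1` modulo `r p`, hence `n = p n'` with `n' ≡ 1` modulo `r` and `n'` coprime to `Q - 1`
(`exists_cofactor`). The coset of `i` is the orbit of `i` under multiplication by `q` modulo `n r`,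
so its size divides `e` iff `n r ∣ i (q^e - 1)`. This size is `p` when `n' ∣ i` and `p^b` otherwise.
Exactly `p` elements of `Z_{n,r}` are multiples of `n'`, which gives all the counts
(`coset_counts`).

A union `T` of cosets is stable under Frobenius, so it defines a code of dimension `n - |T|`, and
the BCH bound gives distance at least `κ + 1` once `1, 1 + r, …, 1 + (κ-1) r` all lie in `T`
(`exists_code_of_definingSet`). Take `1 + κ r` to be the first omitted leader of size `p^b`: every
smaller index in a coset of that size has a selected leader. Among the `κ` indices below it lie `k`
leaders and at least `⌊κ/q⌋` multiples of `q`, which are never leaders. The triples give further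
non-leaders, not divisible by `q`. Hence `k + |S| + ⌊κ/q⌋ ≤ κ`, and solving for `κ` gives `κ + 1 ≥
⌈q (k + |S|)/(q-1)⌉`.

In (a) the coset of size `p` is included, so the run really reaches `κ`. In (b) it is left out and
the run may stop earlier, at its least element `n'`; the condition on `r` says that `n'` lies far
enough out. -/

theorem mem_cyclotomicCoset {q M i k : ℕ} :
    k ∈ cyclotomicCoset q M i ↔ (1 ≤ k ∧ k ≤ M) ∧ ∃ j : ℕ, k ≡ i * q ^ j [MOD M] := by
  simp [cyclotomicCoset]

theorem mem_indexSet {n r i : ℕ} : i ∈ indexSet n r ↔ ∃ k < n, 1 + k * r = i := by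
  simp [indexSet]

theorem card_indexSet {n r : ℕ} (hr : 0 < r) : (indexSet n r).card = n := by
  rw [indexSet, Finset.card_image_of_injective, Finset.card_range]
  intro a b h
  exact Nat.eq_of_mul_eq_mul_right hr (Nat.add_left_cancel h)

/-- In this form, stability under multiplication by `q` is immediate from `q ≡ 1` modulo `r`. -/
theorem mem_indexSet_iff_modEq {n r i : ℕ} (hr : 0 < r) :
    i ∈ indexSet n r ↔ (1 ≤ i ∧ i ≤ n * r) ∧ i ≡ 1 [MOD r] := by
  rw [mem_indexSet]
  constructor
  · rintro ⟨k, hk, rfl⟩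
    refine ⟨⟨by omega, ?_⟩, ?_⟩
    · have : (k + 1) * r ≤ n * r := Nat.mul_le_mul_right _ hk
      nlinarith
    · simp [Nat.ModEq]
  · rintro ⟨⟨h1, h2⟩, h⟩
    obtain ⟨k, hk⟩ := (Nat.modEq_iff_dvd' h1).1 h.symm
    have hi : 1 + k * r = i := by rw [mul_comm k]; omega
    refine ⟨k, ?_, hi⟩
    by_contra hkn
    have : n * r ≤ k * r := Nat.mul_le_mul_right _ (not_lt.1 hkn)
    omega

theorem exists_modEq_mem_Icc {M : ℕ} (hM : 0 < M) (x : ℕ) :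
    ∃ k, (1 ≤ k ∧ k ≤ M) ∧ k ≡ x [MOD M] := by
  rcases Nat.eq_zero_or_pos (x % M) with h | h
  · exact ⟨M, ⟨hM, le_rfl⟩, by simp [Nat.ModEq, h]⟩
  · exact ⟨x % M, ⟨h, (Nat.mod_lt _ hM).le⟩, Nat.mod_modEq _ _⟩

theorem self_mem_cyclotomicCoset {q M i : ℕ} (h1 : 1 ≤ i) (h2 : i ≤ M) :
    i ∈ cyclotomicCoset q M i :=
  mem_cyclotomicCoset.2 ⟨⟨h1, h2⟩, 0, by simp [Nat.ModEq]⟩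

theorem mul_pow_mul_modEq {q M m : ℕ} (hm : q ^ m ≡ 1 [MOD M]) (i j : ℕ) :
    i * q ^ (m * j) ≡ i [MOD M] := by
  have := (hm.pow j).mul_left i
  rwa [one_pow, mul_one, ← pow_mul] at this

theorem cyclotomicCoset_eq_of_mem {q M m i k : ℕ} (hm0 : 0 < m) (hm : q ^ m ≡ 1 [MOD M])
    (hk : k ∈ cyclotomicCoset q M i) : cyclotomicCoset q M k = cyclotomicCoset q M i := by
  obtain ⟨-, j₀, hj₀⟩ := mem_cyclotomicCoset.1 hk
  ext x
  simp only [mem_cyclotomicCoset, and_congr_right_iff]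
  intro _
  constructor
  · rintro ⟨j, hj⟩
    refine ⟨j₀ + j, hj.trans ?_⟩
    rw [pow_add, ← mul_assoc]
    exact hj₀.mul_right _
  · rintro ⟨j, hj⟩
    -- Since `q^m ≡ 1`, the factor `q^((m-1) j₀)` inverts `q^j₀`.
    refine ⟨(m - 1) * j₀ + j, hj.trans ?_⟩
    have h1 := hj₀.mul_right (q ^ ((m - 1) * j₀))
    rw [mul_assoc, ← pow_add] at h1
    have h2 : j₀ + (m - 1) * j₀ = m * j₀ := by
      obtain ⟨a, rfl⟩ := Nat.exists_eq_succ_of_ne_zero hm0.ne'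
      simp; ring
    rw [h2] at h1
    rw [pow_add, ← mul_assoc]
    exact ((h1.trans (mul_pow_mul_modEq hm i j₀)).mul_right _).symm

theorem cyclotomicCoset_subset_indexSet {q n r i : ℕ} (hr : 0 < r) (hq : q ≡ 1 [MOD r])
    (hi : i ∈ indexSet n r) : cyclotomicCoset q (n * r) i ⊆ indexSet n r := by
  intro k hk
  obtain ⟨h, j, hj⟩ := mem_cyclotomicCoset.1 hk
  rw [mem_indexSet_iff_modEq hr] at hi ⊢
  refine ⟨h, (hj.of_mul_left n).trans ?_⟩
  simpa using hi.2.mul (hq.pow j)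

theorem iterate_mul_right_zmod (q M i j : ℕ) :
    (fun x : ZMod M => x * q)^[j] i = ((i * q ^ j : ℕ) : ZMod M) := by
  induction j with
  | zero => simp
  | succ j ih => rw [Function.iterate_succ_apply', ih]; push_cast; ring

theorem isPeriodicPt_mul_right_zmod_iff {q M i e : ℕ} :
    Function.IsPeriodicPt (fun x : ZMod M => x * q) e i ↔ i * q ^ e ≡ i [MOD M] := by
  rw [Function.IsPeriodicPt, Function.IsFixedPt, iterate_mul_right_zmod,
    ZMod.natCast_eq_natCast_iff]

/-- The coset is the orbit of `i` under `x ↦ x q`, so coset sizes reduce to divisibility questions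
about periods. -/
theorem card_cyclotomicCoset {q M m i : ℕ} (hM : 0 < M) (hm0 : 0 < m) (hm : q ^ m ≡ 1 [MOD M]) :
    (cyclotomicCoset q M i).card =
      Function.minimalPeriod (fun x : ZMod M => x * q) (i : ZMod M) := by
  set f : ZMod M → ZMod M := fun x => x * q with hf
  have hper : (i : ZMod M) ∈ Function.periodicPts f :=
    ⟨m, hm0, isPeriodicPt_mul_right_zmod_iff.2 (by simpa using mul_pow_mul_modEq hm i 1)⟩
  have hinj : Set.InjOn (fun k : ℕ => (k : ZMod M)) (cyclotomicCoset q M i) := by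
    intro a ha b hb hab
    obtain ⟨⟨ha1, ha2⟩, -⟩ := mem_cyclotomicCoset.1 ha
    obtain ⟨⟨hb1, hb2⟩, -⟩ := mem_cyclotomicCoset.1 hb
    have hab : a ≡ b [MOD M] := (ZMod.natCast_eq_natCast_iff _ _ _).1 hab
    rcases le_total a b with h | h
    · have := Nat.eq_zero_of_dvd_of_lt ((Nat.modEq_iff_dvd' h).1 hab) (by omega)
      omega
    · have := Nat.eq_zero_of_dvd_of_lt ((Nat.modEq_iff_dvd' h).1 hab.symm) (by omega)
      omega
  have himg : (cyclotomicCoset q M i).image (fun k : ℕ => (k : ZMod M)) =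
      (Finset.range (Function.minimalPeriod f i)).image (fun j => f^[j] i) := by
    ext x
    simp only [Finset.mem_image, Finset.mem_range, mem_cyclotomicCoset]
    constructor
    · rintro ⟨k, ⟨-, j, hj⟩, rfl⟩
      refine ⟨j % Function.minimalPeriod f i,
        Nat.mod_lt _ (Function.minimalPeriod_pos_of_mem_periodicPts hper), ?_⟩
      rw [Function.iterate_mod_minimalPeriod_eq, iterate_mul_right_zmod,
        (ZMod.natCast_eq_natCast_iff _ _ _).2 hj.symm]
    · rintro ⟨j, -, rfl⟩
      obtain ⟨k, hk, hkj⟩ := exists_modEq_mem_Icc hM (i * q ^ j)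
      refine ⟨k, ⟨hk, j, hkj⟩, ?_⟩
      rw [iterate_mul_right_zmod, (ZMod.natCast_eq_natCast_iff _ _ _).2 hkj]
  rw [← Finset.card_image_of_injOn hinj, himg, Finset.card_image_of_injOn, Finset.card_range]
  intro a ha b hb hab
  exact Function.iterate_injOn_Iio_minimalPeriod (by simpa using ha) (by simpa using hb) hab

/-! ### Counting cosets -/

section Counting

variable {q n r m : ℕ}

theorem exists_cosetLeader_le (hr : 0 < r) (hq : q ≡ 1 [MOD r]) (hm0 : 0 < m)
    (hm : q ^ m ≡ 1 [MOD n * r]) {l x : ℕ} (hx : x ∈ indexSet n r)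
    (hl : (cyclotomicCoset q (n * r) x).card = l) :
    ∃ u ∈ cosetLeaders q n r l, u ≤ x ∧
      cyclotomicCoset q (n * r) u = cyclotomicCoset q (n * r) x := by
  have hx' := ((mem_indexSet_iff_modEq hr).1 hx).1
  have hself := self_mem_cyclotomicCoset (q := q) hx'.1 hx'.2
  obtain ⟨u, hu, hmin⟩ := Finset.exists_min_image (cyclotomicCoset q (n * r) x) id ⟨x, hself⟩
  have hcu := cyclotomicCoset_eq_of_mem hm0 hm hu
  refine ⟨u, ?_, hmin x hself, hcu⟩
  simp only [cosetLeaders, Finset.mem_filter]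
  exact ⟨cyclotomicCoset_subset_indexSet hr hq hx hu, by rw [hcu, hl], by rw [hcu]; exact hmin⟩

theorem mem_indexSet_of_mem_cosetLeaders {l u : ℕ} (hu : u ∈ cosetLeaders q n r l) :
    u ∈ indexSet n r := (Finset.mem_filter.1 hu).1

theorem card_of_mem_cosetLeaders {l u : ℕ} (hu : u ∈ cosetLeaders q n r l) :
    (cyclotomicCoset q (n * r) u).card = l := (Finset.mem_filter.1 hu).2.1

theorem injOn_cyclotomicCoset_cosetLeaders (hr : 0 < r) (l : ℕ) :
    Set.InjOn (cyclotomicCoset q (n * r)) (cosetLeaders q n r l) := by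
  intro u hu v hv h
  have hu' := ((mem_indexSet_iff_modEq hr).1 (mem_indexSet_of_mem_cosetLeaders hu)).1
  have hv' := ((mem_indexSet_iff_modEq hr).1 (mem_indexSet_of_mem_cosetLeaders hv)).1
  apply le_antisymm
  · refine (Finset.mem_filter.1 hu).2.2 v ?_
    rw [h]; exact self_mem_cyclotomicCoset hv'.1 hv'.2
  · refine (Finset.mem_filter.1 hv).2.2 u ?_
    rw [← h]; exact self_mem_cyclotomicCoset hu'.1 hu'.2

theorem card_cosetLeaders (hr : 0 < r) (hq : q ≡ 1 [MOD r]) (hm0 : 0 < m)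
    (hm : q ^ m ≡ 1 [MOD n * r]) (l : ℕ) :
    (cosetLeaders q n r l).card = numCosets q n r l := by
  rw [numCosets, ← Finset.card_image_of_injOn (injOn_cyclotomicCoset_cosetLeaders hr l)]
  congr 1
  ext C
  simp only [Finset.mem_image, Finset.mem_filter]
  constructor
  · rintro ⟨u, hu, rfl⟩
    exact ⟨⟨u, mem_indexSet_of_mem_cosetLeaders hu, rfl⟩, card_of_mem_cosetLeaders hu⟩
  · rintro ⟨⟨x, hx, rfl⟩, hl⟩
    obtain ⟨u, hu, -, h⟩ := exists_cosetLeader_le hr hq hm0 hm hx hl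
    exact ⟨u, hu, h⟩

theorem card_biUnion_cosetLeaders (hr : 0 < r) (hm0 : 0 < m)
    (hm : q ^ m ≡ 1 [MOD n * r]) {l : ℕ} {L : Finset ℕ} (hL : L ⊆ cosetLeaders q n r l) :
    (L.biUnion (cyclotomicCoset q (n * r))).card = L.card * l := by
  rw [Finset.card_biUnion]
  · exact Finset.sum_const_nat fun u hu => card_of_mem_cosetLeaders (hL hu)
  · intro u hu v hv huv
    refine Finset.disjoint_left.2 ?_
    intro x hxu hxv
    apply huv
    apply injOn_cyclotomicCoset_cosetLeaders hr l (hL hu) (hL hv)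
    rw [← cyclotomicCoset_eq_of_mem hm0 hm hxu, ← cyclotomicCoset_eq_of_mem hm0 hm hxv]

theorem numCosets_mul (hr : 0 < r) (hq : q ≡ 1 [MOD r]) (hm0 : 0 < m)
    (hm : q ^ m ≡ 1 [MOD n * r]) (l : ℕ) :
    numCosets q n r l * l =
      ((indexSet n r).filter (fun i => (cyclotomicCoset q (n * r) i).card = l)).card := by
  rw [← card_cosetLeaders hr hq hm0 hm, ← card_biUnion_cosetLeaders hr hm0 hm subset_rfl]
  congr 1
  ext x
  simp only [Finset.mem_biUnion, Finset.mem_filter]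
  constructor
  · rintro ⟨u, hu, hx⟩
    exact ⟨cyclotomicCoset_subset_indexSet hr hq (mem_indexSet_of_mem_cosetLeaders hu) hx,
      by rw [cyclotomicCoset_eq_of_mem hm0 hm hx, card_of_mem_cosetLeaders hu]⟩
  · rintro ⟨hx, hl⟩
    obtain ⟨u, hu, -, h⟩ := exists_cosetLeader_le hr hq hm0 hm hx hl
    refine ⟨u, hu, ?_⟩
    have hx' := ((mem_indexSet_iff_modEq hr).1 hx).1
    rw [h]; exact self_mem_cyclotomicCoset hx'.1 hx'.2

/-- If `k` is less than the size of `L`, the `k` smallest elements of `L` are those below some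
element of `L`. -/
theorem exists_threshold {L : Finset ℕ} {k : ℕ} (hk : k < L.card) :
    ∃ v ∈ L, (L.filter (fun j => j < v)).card = k ∧
      ∀ i ∈ L, (L.filter (fun j => j < i)).card < k ↔ i < v := by
  have hc : ∀ i, (L.filter (fun j => j < i)).card = Nat.count (· ∈ L) i := by
    intro i
    rw [Nat.count_eq_card_filter_range]
    congr 1
    ext j
    simp [and_comm]
  have hk' : ∀ hf : (Set.ofPred (· ∈ L)).Finite, k < hf.toFinset.card := by
    intro hf
    convert hk using 2
    ext; simp
  have hv : Nat.nth (· ∈ L) k ∈ L := Nat.nth_mem k hk'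
  have hcv : Nat.count (· ∈ L) (Nat.nth (· ∈ L) k) = k := Nat.count_nth hk'
  refine ⟨_, hv, by rw [hc, hcv], fun i hi => ?_⟩
  rw [hc]
  constructor
  · intro h
    by_contra h'
    have := Nat.count_monotone (· ∈ L) (not_lt.1 h')
    omega
  · intro h
    have := Nat.count_strict_mono (p := (· ∈ L)) hi h
    omega

theorem card_filter_card_lt {L : Finset ℕ} {k : ℕ} (hk : k ≤ L.card) :
    (L.filter (fun i => (L.filter (fun j => j < i)).card < k)).card = k := by
  rcases hk.lt_or_eq with h | rfl
  · obtain ⟨v, -, hv, h⟩ := exists_threshold h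
    rw [Finset.filter_congr h, hv]
  · rw [Finset.filter_true_of_mem]
    intro i hi
    apply Finset.card_lt_card
    rw [Finset.filter_ssubset]
    exact ⟨i, hi, lt_irrefl _⟩

theorem card_firstCosets (hr : 0 < r) (hq : q ≡ 1 [MOD r]) (hm0 : 0 < m)
    (hm : q ^ m ≡ 1 [MOD n * r]) {l k : ℕ} (hk : k ≤ numCosets q n r l) :
    (firstCosets q n r l k).card = k * l := by
  rw [firstCosets, card_biUnion_cosetLeaders hr hm0 hm (Finset.filter_subset _ _),
    card_filter_card_lt]
  rwa [card_cosetLeaders hr hq hm0 hm]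

theorem firstCosets_subset (hr : 0 < r) (hq : q ≡ 1 [MOD r]) (l k : ℕ) :
    firstCosets q n r l k ⊆ indexSet n r := by
  rw [firstCosets, Finset.biUnion_subset]
  intro u hu
  exact cyclotomicCoset_subset_indexSet hr hq
    (mem_indexSet_of_mem_cosetLeaders (Finset.filter_subset _ _ hu))

theorem card_of_mem_firstCosets (hm0 : 0 < m) (hm : q ^ m ≡ 1 [MOD n * r]) {l k x : ℕ}
    (hx : x ∈ firstCosets q n r l k) : (cyclotomicCoset q (n * r) x).card = l := by
  rw [firstCosets, Finset.mem_biUnion] at hx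
  obtain ⟨u, hu, hx⟩ := hx
  rw [cyclotomicCoset_eq_of_mem hm0 hm hx]
  exact card_of_mem_cosetLeaders (Finset.filter_subset _ _ hu)

theorem firstCosets_numCosets (hr : 0 < r) (hq : q ≡ 1 [MOD r]) (hm0 : 0 < m)
    (hm : q ^ m ≡ 1 [MOD n * r]) (l : ℕ) :
    firstCosets q n r l (numCosets q n r l) =
      (indexSet n r).filter (fun i => (cyclotomicCoset q (n * r) i).card = l) := by
  apply Finset.eq_of_subset_of_card_le
  · exact fun x hx => Finset.mem_filter.2
      ⟨firstCosets_subset hr hq _ _ hx, card_of_mem_firstCosets hm0 hm hx⟩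
  · rw [card_firstCosets hr hq hm0 hm le_rfl, numCosets_mul hr hq hm0 hm]

theorem exists_mem_firstCosets_modEq_mul (hM : 0 < n * r) (hm0 : 0 < m)
    (hm : q ^ m ≡ 1 [MOD n * r]) {l k x : ℕ} (hx : x ∈ firstCosets q n r l k) :
    ∃ y ∈ firstCosets q n r l k, y ≡ x * q [MOD n * r] := by
  obtain ⟨y, hy, hyx⟩ := exists_modEq_mem_Icc hM (x * q)
  rw [firstCosets] at hx ⊢
  obtain ⟨u, hu, hx⟩ := Finset.mem_biUnion.1 hx
  refine ⟨y, Finset.mem_biUnion.2 ⟨u, hu, ?_⟩, hyx⟩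
  rw [← cyclotomicCoset_eq_of_mem hm0 hm hx]
  exact mem_cyclotomicCoset.2 ⟨hy, 1, by rwa [pow_one]⟩

/-- Take the `(k+1)`-st leader: an element below it has a still smaller leader, which is therefore
among the first `k`. -/
theorem exists_leader_threshold (hr : 0 < r) (hq : q ≡ 1 [MOD r]) (hm0 : 0 < m)
    (hm : q ^ m ≡ 1 [MOD n * r]) {l k : ℕ} (hk : k < numCosets q n r l) :
    ∃ κ, 1 + κ * r ∈ cosetLeaders q n r l ∧
      ((cosetLeaders q n r l).filter (fun j => j < 1 + κ * r)).card = k ∧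
      ∀ x ∈ indexSet n r, (cyclotomicCoset q (n * r) x).card = l → x < 1 + κ * r →
        x ∈ firstCosets q n r l k := by
  rw [← card_cosetLeaders hr hq hm0 hm] at hk
  obtain ⟨v, hv, hvk, h⟩ := exists_threshold hk
  obtain ⟨κ, -, rfl⟩ := mem_indexSet.1 (mem_indexSet_of_mem_cosetLeaders hv)
  refine ⟨κ, hv, hvk, fun x hx hl hxv => ?_⟩
  obtain ⟨u, hu, hux, hcu⟩ := exists_cosetLeader_le hr hq hm0 hm hx hl
  rw [firstCosets, Finset.mem_biUnion]
  refine ⟨u, Finset.mem_filter.2 ⟨hu, (h u hu).2 (by omega)⟩, ?_⟩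
  have hx' := ((mem_indexSet_iff_modEq hr).1 hx).1
  rw [hcu]; exact self_mem_cyclotomicCoset hx'.1 hx'.2

/-- If `u = q v`, then `v ≡ u q^(m-1)` is a smaller element of the coset of `u`. -/
theorem not_dvd_of_mem_cosetLeaders (hr : 0 < r) (hq1 : 1 < q) (hm0 : 0 < m)
    (hm : q ^ m ≡ 1 [MOD n * r]) {l u : ℕ} (hu : u ∈ cosetLeaders q n r l) : ¬ q ∣ u := by
  rintro ⟨v, rfl⟩
  have hu' := ((mem_indexSet_iff_modEq hr).1 (mem_indexSet_of_mem_cosetLeaders hu)).1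
  have hv : 0 < v := Nat.pos_of_ne_zero (by rintro rfl; simp at hu')
  have hlt : v < q * v := by nlinarith
  refine absurd ((Finset.mem_filter.1 hu).2.2 v (mem_cyclotomicCoset.2 ⟨⟨hv, by omega⟩, m - 1, ?_⟩))
    (not_le.2 hlt)
  have := mul_pow_mul_modEq hm v 1
  obtain ⟨a, rfl⟩ := Nat.exists_eq_succ_of_ne_zero hm0.ne'
  rw [mul_one, pow_succ] at this
  rw [Nat.succ_sub_one]
  convert this.symm using 1
  ring

/-- Among the first `κ` terms of `1, 1 + r, 1 + 2r, …`, at least `κ / q` are multiples of `q`. -/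
theorem card_filter_not_dvd_add_div_le (hq0 : 0 < q) (hrq : r ∣ q - 1) (κ : ℕ) :
    ((Finset.range κ).filter (fun i => ¬ q ∣ 1 + i * r)).card + κ / q ≤ κ := by
  have h1 : κ / q ≤ ((Finset.range κ).filter (fun i => q ∣ 1 + i * r)).card := by
    rw [← Finset.card_range (κ / q)]
    -- For this index, `1 + i r = q (1 + r j)`, because `r ∣ q - 1`.
    apply Finset.card_le_card_of_injOn (fun j => j * q + (q - 1) / r)
    · intro j hj
      have hj : j < κ / q := by simpa using hj
      have hb : (q - 1) / r ≤ q - 1 := Nat.div_le_self _ _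
      have h2 : (j + 1) * q ≤ κ / q * q := Nat.mul_le_mul_right _ hj
      have h3 : κ / q * q ≤ κ := Nat.div_mul_le_self _ _
      simp only [Finset.coe_filter, Finset.mem_range, Set.mem_ofPred_eq]
      refine ⟨by rw [add_mul] at h2; omega, 1 + r * j, ?_⟩
      have h4 := Nat.div_mul_cancel hrq
      rw [add_mul, h4]
      zify [hq0]
      ring
    · intro a _ b _ h
      exact Nat.eq_of_mul_eq_mul_right hq0 (Nat.add_right_cancel h)
  have h2 := Finset.card_filter_add_card_filter_not (s := Finset.range κ) (fun i => q ∣ 1 + i * r)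
  rw [Finset.card_range] at h2
  omega

/-- If the `(k + 1)`-st leader of size `l` is `1 + κ r`, and `D` consists of elements of `Z_{n,r}`
below it which are neither leaders nor multiples of `q`, then `k + |D| ≤ κ - ⌊κ / q⌋`. -/
theorem card_add_card_add_div_le (hr : 0 < r) (hq1 : 1 < q) (hrq : r ∣ q - 1) (hm0 : 0 < m)
    (hm : q ^ m ≡ 1 [MOD n * r]) {l κ : ℕ} {D : Finset ℕ}
    (hD : ∀ x ∈ D, x ≡ 1 [MOD r] ∧ 1 ≤ x ∧ x < 1 + κ * r ∧ ¬ q ∣ x ∧ x ∉ cosetLeaders q n r l) :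
    ((cosetLeaders q n r l).filter (fun j => j < 1 + κ * r)).card + D.card + κ / q ≤ κ := by
  refine le_trans (Nat.add_le_add_right ?_ _) (card_filter_not_dvd_add_div_le (by omega) hrq κ)
  rw [← Finset.card_union_of_disjoint]
  · have hsub : (cosetLeaders q n r l).filter (fun j => j < 1 + κ * r) ∪ D ⊆
        ((Finset.range κ).filter (fun i => ¬ q ∣ 1 + i * r)).image (fun i => 1 + i * r) := by
      intro x hx
      have hx : x ≡ 1 [MOD r] ∧ 1 ≤ x ∧ x < 1 + κ * r ∧ ¬ q ∣ x := by
        rcases Finset.mem_union.1 hx with h | h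
        · obtain ⟨h1, h2⟩ := Finset.mem_filter.1 h
          have h3 := (mem_indexSet_iff_modEq hr).1 (mem_indexSet_of_mem_cosetLeaders h1)
          exact ⟨h3.2, h3.1.1, h2, not_dvd_of_mem_cosetLeaders hr hq1 hm0 hm h1⟩
        · obtain ⟨h1, h2, h3, h4, -⟩ := hD x h
          exact ⟨h1, h2, h3, h4⟩
      obtain ⟨h1, h2, h3, h4⟩ := hx
      have : x ∈ indexSet κ r := (mem_indexSet_iff_modEq hr).2 ⟨⟨h2, by omega⟩, h1⟩
      obtain ⟨i, hi, rfl⟩ := mem_indexSet.1 this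
      simp only [Finset.mem_image, Finset.mem_filter, Finset.mem_range]
      exact ⟨i, ⟨hi, h4⟩, rfl⟩
    exact (Finset.card_le_card hsub).trans Finset.card_image_le
  · rw [Finset.disjoint_left]
    intro x hx hxD
    exact (hD x hxD).2.2.2.2 (Finset.mem_filter.1 hx).1

end Counting

/-! ### The length and the coset sizes -/

theorem codeLength_succ_eq_sum {p c q : ℕ} (hp : p.Prime) (hq : 2 ≤ q) :
    codeLength p (c + 1) q = ∑ j ∈ Finset.range p, (q ^ p ^ c) ^ j := by
  have h2 : 2 ≤ q ^ p ^ c :=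
    hq.trans (Nat.le_self_pow (pow_pos hp.pos _).ne' q)
  rw [Nat.geomSum_eq h2, codeLength, Nat.add_sub_cancel, ← pow_mul, ← pow_succ]

theorem codeLength_succ_mul {p c q : ℕ} (hp : p.Prime) (hq : 2 ≤ q) :
    codeLength p (c + 1) q * (q ^ p ^ c - 1) + 1 = q ^ p ^ (c + 1) := by
  rw [codeLength_succ_eq_sum hp hq]
  have h1 : 1 ≤ q ^ p ^ c := Nat.one_le_pow _ _ (by omega)
  zify [h1]
  rw [geom_sum_mul, ← pow_mul, ← pow_succ]
  ring

theorem codeLength_lt_succ {p c q : ℕ} (hp : p.Prime) (hq : 2 ≤ q) :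
    codeLength p (c + 1) q < codeLength p (c + 2) q := by
  rw [codeLength_succ_eq_sum hp hq, codeLength_succ_eq_sum hp hq]
  have hlt : q ^ p ^ c < q ^ p ^ (c + 1) :=
    Nat.pow_lt_pow_right (by omega) (Nat.pow_lt_pow_right hp.one_lt (by omega))
  refine Finset.sum_lt_sum (fun j _ => Nat.pow_le_pow_left hlt.le j) ⟨1, ?_, by simpa using hlt⟩
  exact Finset.mem_range.2 hp.one_lt

theorem codeLength_succ_eq_eval {p c q : ℕ} (hp : p.Prime) (hq : 2 ≤ q) :
    (codeLength p (c + 1) q : ℤ) = (cyclotomic (p ^ (c + 1)) ℤ).eval (q : ℤ) := by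
  rw [codeLength_succ_eq_sum hp hq, cyclotomic_prime_pow_eq_geom_sum hp, eval_finsetSum]
  push_cast
  simp

/-- This makes the number of large cosets at least 2, so that half of them, rounded up, is not all
of them. Already the terms `1 + q^(p^c)` of the sum suffice. -/
theorem add_lt_codeLength {p c q : ℕ} (hp : p.Prime) (hpq : p < q) (hc : 1 ≤ c) :
    p + p ^ (c + 1) < codeLength p (c + 1) q := by
  have hp2 := hp.two_le
  rw [codeLength_succ_eq_sum hp (by omega)]
  have h1 : ∑ j ∈ Finset.range 2, (q ^ p ^ c) ^ j ≤ ∑ j ∈ Finset.range p, (q ^ p ^ c) ^ j :=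
    Finset.sum_le_sum_of_subset (Finset.range_mono hp2)
  simp only [Finset.sum_range_succ, Finset.sum_range_zero, pow_zero, pow_one] at h1
  have h2 : c + 1 ≤ p ^ c := Nat.lt_pow_self hp.one_lt
  have h3 : (p + 1) ^ (c + 1) ≤ q ^ p ^ c :=
    (Nat.pow_le_pow_left hpq _).trans (Nat.pow_le_pow_right (by omega) h2)
  -- The two leading terms of the binomial expansion.
  have h4 : ∀ k, p ^ (k + 1) + (k + 1) * p ^ k ≤ (p + 1) ^ (k + 1) := by
    intro k
    induction k with
    | zero => simp
    | succ k ih =>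
      rw [pow_succ (p + 1), pow_succ p (k + 1)]
      calc p ^ (k + 1) * p + (k + 1 + 1) * p ^ (k + 1)
          ≤ (p ^ (k + 1) + (k + 1) * p ^ k) * (p + 1) := by
            rw [pow_succ p k]
            nlinarith [Nat.zero_le ((k + 1) * p ^ k)]
        _ ≤ _ := Nat.mul_le_mul_right _ ih
  have h5 : p ≤ p ^ c := Nat.le_self_pow (by omega) p
  have h6 : 1 * p ≤ (c + 1) * p ^ c := Nat.mul_le_mul (by omega) h5
  have := h4 c
  omega

section Arithmetic

variable {p c q r : ℕ}

theorem prime_dvd_of_not_dvd_div (hp : p.Prime) (hr : r ∣ q - 1) (hpq : p ∣ q - 1)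
    (hpr : ¬ p ∣ (q - 1) / r) : p ∣ r := by
  rw [← Nat.mul_div_cancel' hr] at hpq
  exact (hp.dvd_mul.1 hpq).resolve_right hpr

theorem modEq_one_of_dvd_sub_one {d : ℕ} (hq : 1 ≤ q) (hd : d ∣ q - 1) : q ≡ 1 [MOD d] :=
  ((Nat.modEq_iff_dvd' hq).2 hd).symm

theorem dvd_sub_one_of_modEq_one {d : ℕ} (hq : 1 ≤ q) (hd : q ≡ 1 [MOD d]) : d ∣ q - 1 :=
  (Nat.modEq_iff_dvd' hq).1 hd.symm

theorem geomSum_modEq {Q d k : ℕ} (h : Q ≡ 1 [MOD d]) :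
    ∑ j ∈ Finset.range k, Q ^ j ≡ k [MOD d] := by
  induction k with
  | zero => simp [Nat.ModEq]
  | succ k ih =>
    rw [Finset.sum_range_succ]
    simpa using ih.add (h.pow k)

/-- In `q^p - 1 = (q - 1)(1 + q + ⋯ + q^(p-1))`, `r` divides the first factor, and the second is `≡
p ≡ 0` modulo `p`. -/
theorem pow_prime_modEq_one (hq : 2 ≤ q) (hr : r ∣ q - 1) (hpq : p ∣ q - 1) :
    q ^ p ≡ 1 [MOD r * p] := by
  refine modEq_one_of_dvd_sub_one (Nat.one_le_pow _ _ (by omega)) ?_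
  have h1 : q ^ p - 1 = (q - 1) * ∑ j ∈ Finset.range p, q ^ j := by
    have : 1 ≤ q := by omega
    have : 1 ≤ q ^ p := Nat.one_le_pow _ _ (by omega)
    zify [*]
    rw [mul_geom_sum]
  rw [h1]
  refine mul_dvd_mul hr ?_
  have := geomSum_modEq (k := p) (modEq_one_of_dvd_sub_one (by omega) hpq)
  exact (Nat.modEq_zero_iff_dvd).1 (this.trans (by simp [Nat.ModEq]))

theorem pow_prime_pow_modEq_one (hq : 2 ≤ q) (hr : r ∣ q - 1) (hpq : p ∣ q - 1) (hc : 1 ≤ c) :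
    q ^ p ^ c ≡ 1 [MOD r * p] := by
  obtain ⟨c, rfl⟩ := Nat.exists_eq_add_of_le hc
  rw [pow_add, pow_one, pow_mul]
  simpa using (pow_prime_modEq_one hq hr hpq).pow (p ^ c)

/-- The geometric sum is `≡ p` modulo `r p`; cancel `p`. It is also `≡ p` modulo `Q - 1`, with `Q =
q ^ p ^ c`, so a common divisor of `n'` and `Q - 1` divides `p`; it is not `p`, as `p ∣ r` and `n' ≡
1` modulo `r`. -/
theorem exists_cofactor (hp : p.Prime) (hq : 2 ≤ q) (hr : r ∣ q - 1)
    (hpq : p ∣ q - 1) (hpr : p ∣ r) (hc : 1 ≤ c) :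
    ∃ n', codeLength p (c + 1) q = p * n' ∧ n' ≡ 1 [MOD r] ∧ n'.Coprime (q ^ p ^ c - 1) := by
  have hQ1 : 1 ≤ q ^ p ^ c := Nat.one_le_pow _ _ (by omega)
  have hsum := codeLength_succ_eq_sum (c := c) hp hq
  have h1 : codeLength p (c + 1) q ≡ p [MOD r * p] := by
    rw [hsum]; exact geomSum_modEq (pow_prime_pow_modEq_one hq hr hpq hc)
  obtain ⟨n', hn'⟩ : p ∣ codeLength p (c + 1) q :=
    Nat.modEq_zero_iff_dvd.1 ((h1.of_mul_left r).trans (by simp [Nat.ModEq]))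
  have hmod : n' ≡ 1 [MOD r] := by
    rw [hn', mul_comm r p] at h1
    exact Nat.ModEq.mul_left_cancel' hp.ne_zero (by simpa using h1)
  refine ⟨n', hn', hmod, ?_⟩
  have h2 : codeLength p (c + 1) q ≡ p [MOD q ^ p ^ c - 1] := by
    rw [hsum]; exact geomSum_modEq (modEq_one_of_dvd_sub_one hQ1 dvd_rfl)
  set d := n'.gcd (q ^ p ^ c - 1) with hd
  have hdn : d ∣ n' := Nat.gcd_dvd_left _ _
  have hdp : d ∣ p := by
    have h3 := h2.of_dvd (Nat.gcd_dvd_right n' (q ^ p ^ c - 1))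
    refine Nat.modEq_zero_iff_dvd.1 (h3.symm.trans (Nat.modEq_zero_iff_dvd.2 ?_))
    rw [hn']; exact Dvd.dvd.mul_left hdn p
  rcases (Nat.dvd_prime hp).1 hdp with h | h
  · exact h
  · exfalso
    rw [h] at hdn
    have h4 := (hmod.of_dvd hpr).symm.trans (Nat.modEq_zero_iff_dvd.2 hdn)
    exact hp.one_lt.ne' (Nat.dvd_one.1 (Nat.modEq_zero_iff_dvd.1 h4))

theorem mul_pow_modEq_iff_dvd (hq : 2 ≤ q) {M i e : ℕ} :
    i * q ^ e ≡ i [MOD M] ↔ M ∣ i * (q ^ e - 1) := by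
  have h1 : 1 ≤ q ^ e := Nat.one_le_pow _ _ (by omega)
  have h2 : i ≤ i * q ^ e := Nat.le_mul_of_pos_right _ h1
  rw [Nat.mul_sub, mul_one, ← Nat.modEq_iff_dvd' h2]
  exact ⟨fun h => h.symm, fun h => h.symm⟩

theorem coprime_of_modEq_one {i d : ℕ} (h : i ≡ 1 [MOD d]) : i.Coprime d := by
  rw [Nat.Coprime, h.gcd_eq]; simp

theorem pow_modEq_one_codeLength_mul (hp : p.Prime) (hq : 2 ≤ q) (hr : r ∣ q - 1) :
    q ^ p ^ (c + 1) ≡ 1 [MOD codeLength p (c + 1) q * r] := by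
  refine modEq_one_of_dvd_sub_one (Nat.one_le_pow _ _ (by omega)) ?_
  rw [← codeLength_succ_mul hp hq, Nat.add_sub_cancel]
  exact mul_dvd_mul_left _ (hr.trans (by simpa using Nat.sub_dvd_pow_sub_pow q 1 (p ^ c)))

theorem codeLength_succ_pos (hp : p.Prime) (hq : 2 ≤ q) : 0 < codeLength p (c + 1) q := by
  rw [codeLength_succ_eq_sum hp hq]
  exact Finset.sum_pos (fun j _ => pow_pos (pow_pos (by omega) _) _) ⟨0, by simpa using hp.pos⟩

/-- The coset of `i` has `p` elements if `n / p` divides `i`, and `p ^ b` elements otherwise. -/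
theorem card_cyclotomicCoset_codeLength (hp : p.Prime) (hq : 2 ≤ q) (hr0 : 0 < r)
    (hr : r ∣ q - 1) (hpq : p ∣ q - 1) (hpr : ¬ p ∣ (q - 1) / r) {n' i : ℕ}
    (hn' : codeLength p (c + 1) q = p * n') (hcop : n'.Coprime (q ^ p ^ c - 1))
    (hi : i ≡ 1 [MOD r]) :
    (cyclotomicCoset q (codeLength p (c + 1) q * r) i).card =
      if n' ∣ i then p else p ^ (c + 1) := by
  have hm := pow_modEq_one_codeLength_mul (c := c) hp hq hr
  have hpr' := prime_dvd_of_not_dvd_div hp hr hpq hpr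
  have hn0 := codeLength_succ_pos (c := c) hp hq
  rw [card_cyclotomicCoset (Nat.mul_pos hn0 hr0) (pow_pos hp.pos _) hm]
  set n := codeLength p (c + 1) q with hn
  set P := Function.minimalPeriod (fun x : ZMod (n * r) => x * q) (i : ZMod (n * r)) with hP
  have hdvd : ∀ e, P ∣ e ↔ n * r ∣ i * (q ^ e - 1) := by
    intro e
    rw [hP, ← Function.isPeriodicPt_iff_minimalPeriod_dvd, isPeriodicPt_mul_right_zmod_iff,
      mul_pow_modEq_iff_dvd hq]
  -- Period 1 would give `r p ∣ i (q - 1)`. Here `i` is coprime to `r p`, so `p` would divide `(q -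
  -- 1) / r`.
  have hone : P ≠ 1 := by
    intro h
    have h1 := (hdvd 1).1 (by rw [h])
    rw [pow_one] at h1
    have h2 : r * p ∣ i * (q - 1) := Dvd.dvd.trans ⟨n', by rw [hn']; ring⟩ h1
    have h3 : (r * p).Coprime i :=
      (Nat.Coprime.mul_right (coprime_of_modEq_one hi)
        (coprime_of_modEq_one (hi.of_dvd hpr'))).symm
    have h4 := h3.dvd_of_dvd_mul_left h2
    rw [← Nat.mul_div_cancel' hr] at h4
    exact hpr (Nat.dvd_of_mul_dvd_mul_left hr0 h4)
  split_ifs with hdi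
  · obtain ⟨k, rfl⟩ := hdi
    have h1 : P ∣ p := by
      rw [hdvd, hn', show p * n' * r = n' * (r * p) by ring, mul_assoc]
      refine mul_dvd_mul_left _ (Dvd.dvd.mul_left ?_ _)
      exact dvd_sub_one_of_modEq_one (Nat.one_le_pow _ _ (by omega)) (pow_prime_modEq_one hq hr hpq)
    exact ((Nat.dvd_prime hp).1 h1).resolve_left hone
  · have h1 : P ∣ p ^ (c + 1) := by
      rw [hdvd]
      exact Dvd.dvd.mul_left (dvd_sub_one_of_modEq_one (Nat.one_le_pow _ _ (by omega)) hm) _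
    obtain ⟨e, he, hPe⟩ := (Nat.dvd_prime_pow hp).1 h1
    rcases he.lt_or_eq with h | h
    -- A proper divisor of `p^(c+1)` divides `p^c`; then `n' ∣ i (q^(p^c) - 1)`, and coprimality
    -- forces `n' ∣ i`.
    · exfalso
      have h2 : P ∣ p ^ c := by rw [hPe]; exact pow_dvd_pow _ (by omega)
      rw [hdvd] at h2
      exact hdi (hcop.dvd_of_dvd_mul_right (Dvd.dvd.trans ⟨p * r, by rw [hn']; ring⟩ h2))
    · rw [hPe, h]

/-- As `n' ≡ 1` modulo `r`, these multiples are `n'` times the elements of `Z_{p,r}`. -/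
theorem card_filter_dvd_indexSet {n' : ℕ} (hr0 : 0 < r) (hn0 : 0 < n') (hn' : n' ≡ 1 [MOD r]) :
    ((indexSet (p * n') r).filter (fun i => n' ∣ i)).card = p := by
  have : (indexSet (p * n') r).filter (fun i => n' ∣ i) = (indexSet p r).image (n' * ·) := by
    ext x
    simp only [Finset.mem_filter, Finset.mem_image, mem_indexSet_iff_modEq hr0]
    constructor
    · rintro ⟨⟨⟨h1, h2⟩, h3⟩, k, rfl⟩
      refine ⟨k, ⟨⟨Nat.pos_of_mul_pos_left h1, ?_⟩, ?_⟩, rfl⟩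
      · rw [mul_comm p, mul_assoc] at h2
        exact Nat.le_of_mul_le_mul_left h2 hn0
      · simpa using ((hn'.mul_right k).symm.trans h3)
    · rintro ⟨k, ⟨⟨h1, h2⟩, h3⟩, rfl⟩
      refine ⟨⟨⟨Nat.mul_pos hn0 h1, ?_⟩, ?_⟩, dvd_mul_right _ _⟩
      · rw [mul_comm p, mul_assoc]
        exact Nat.mul_le_mul_left _ h2
      · simpa using hn'.mul h3
  rw [this, Finset.card_image_of_injective, card_indexSet hr0]
  intro a b h
  exact Nat.eq_of_mul_eq_mul_left hn0 h

theorem coset_counts (hp : p.Prime) (hq : 2 ≤ q) (hr0 : 0 < r)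
    (hr : r ∣ q - 1) (hpq : p ∣ q - 1) (hpr : ¬ p ∣ (q - 1) / r) (hc : 1 ≤ c) :
    cosetSizes q (codeLength p (c + 1) q) r = {p, p ^ (c + 1)} ∧
      numCosets q (codeLength p (c + 1) q) r p = 1 ∧
      numCosets q (codeLength p (c + 1) q) r (p ^ (c + 1)) * p ^ (c + 1) + p =
        codeLength p (c + 1) q ∧
      2 ≤ numCosets q (codeLength p (c + 1) q) r (p ^ (c + 1)) := by
  have hpr' := prime_dvd_of_not_dvd_div hp hr hpq hpr
  obtain ⟨n', hn', hmod, hcop⟩ := exists_cofactor hp hq hr hpq hpr' hc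
  have hcard := fun i hi => card_cyclotomicCoset_codeLength (i := i) hp hq hr0 hr hpq hpr
    hn' hcop hi
  have hm := pow_modEq_one_codeLength_mul (c := c) hp hq hr
  have hm0 : 0 < p ^ (c + 1) := pow_pos hp.pos _
  have hn0 := codeLength_succ_pos (c := c) hp hq
  have hq1 := modEq_one_of_dvd_sub_one (by omega) hr
  have hlt := add_lt_codeLength (q := q) hp (by have := Nat.le_of_dvd (by omega) hpq; omega) hc
  have hn'0 : 0 < n' := Nat.pos_of_mul_pos_left (hn' ▸ hn0 : 0 < p * n')
  have hpp : p < p ^ (c + 1) := by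
    simpa using Nat.pow_lt_pow_right hp.one_lt (show 1 < c + 1 by omega)
  have hfil : ((indexSet (codeLength p (c + 1) q) r).filter (fun i => n' ∣ i)).card = p := by
    rw [hn']; exact card_filter_dvd_indexSet hr0 hn'0 hmod
  have hN1 := numCosets_mul hr0 hq1 hm0 hm p
  have hN2 := numCosets_mul hr0 hq1 hm0 hm (p ^ (c + 1))
  have e1 : (indexSet (codeLength p (c + 1) q) r).filter
      (fun i => (cyclotomicCoset q (codeLength p (c + 1) q * r) i).card = p) =
      (indexSet (codeLength p (c + 1) q) r).filter (fun i => n' ∣ i) := by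
    refine Finset.filter_congr fun i hi => ?_
    rw [hcard i ((mem_indexSet_iff_modEq hr0).1 hi).2]
    split_ifs with h
    · simp [h]
    · simp [h, hpp.ne']
  have e2 : (indexSet (codeLength p (c + 1) q) r).filter
      (fun i => (cyclotomicCoset q (codeLength p (c + 1) q * r) i).card = p ^ (c + 1)) =
      (indexSet (codeLength p (c + 1) q) r).filter (fun i => ¬ n' ∣ i) := by
    refine Finset.filter_congr fun i hi => ?_
    rw [hcard i ((mem_indexSet_iff_modEq hr0).1 hi).2]
    split_ifs with h
    · simp [h, hpp.ne]
    · simp [h]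
  have h3 := Finset.card_filter_add_card_filter_not
    (s := indexSet (codeLength p (c + 1) q) r) (fun i => n' ∣ i)
  rw [card_indexSet hr0, hfil] at h3
  rw [e1, hfil] at hN1
  rw [e2] at hN2
  have hN2' : numCosets q (codeLength p (c + 1) q) r (p ^ (c + 1)) * p ^ (c + 1) + p =
      codeLength p (c + 1) q := by omega
  refine ⟨?_, Nat.eq_of_mul_eq_mul_right hp.pos (by simpa using hN1), hN2', ?_⟩
  · ext l
    simp only [cosetSizes, Finset.mem_image, Finset.mem_insert, Finset.mem_singleton]
    constructor
    · rintro ⟨i, hi, rfl⟩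
      rw [hcard i ((mem_indexSet_iff_modEq hr0).1 hi).2]
      split_ifs <;> simp
    · rintro (rfl | rfl)
      · have : 0 < ((indexSet (codeLength l (c + 1) q) r).filter (fun i => n' ∣ i)).card := by
          rw [hfil]; exact hp.pos
        rw [← e1] at this
        obtain ⟨i, hi⟩ := Finset.card_pos.1 this
        exact ⟨i, (Finset.mem_filter.1 hi).1, (Finset.mem_filter.1 hi).2⟩
      · have : 0 < ((indexSet (codeLength p (c + 1) q) r).filter (fun i => ¬ n' ∣ i)).card := by
          omega
        rw [← e2] at this
        obtain ⟨i, hi⟩ := Finset.card_pos.1 this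
        exact ⟨i, (Finset.mem_filter.1 hi).1, (Finset.mem_filter.1 hi).2⟩
  · by_contra h
    have : numCosets q (codeLength p (c + 1) q) r (p ^ (c + 1)) * p ^ (c + 1) ≤
      1 * p ^ (c + 1) := Nat.mul_le_mul_right _ (by omega)
    omega

end Arithmetic

/-! ### Constacyclic codes -/

/-- The elements of `F` already exhaust the roots of `X^|F| - X`, by degree. -/
theorem mem_range_algebraMap_of_pow_card_eq_self {F K : Type*} [Field F] [Fintype F] [Field K]
    [Algebra F K] {x : K} (hx : x ^ Fintype.card F = x) : x ∈ Set.range (algebraMap F K) := by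
  classical
  have hq : 1 < Fintype.card F := Fintype.one_lt_card
  have h0 : (X ^ Fintype.card F - X : K[X]) ≠ 0 := FiniteField.X_pow_card_sub_X_ne_zero K hq
  have hmem : ∀ y : K, y ∈ (X ^ Fintype.card F - X : K[X]).roots.toFinset ↔
      y ^ Fintype.card F = y := by
    intro y
    rw [Multiset.mem_toFinset, mem_roots h0, IsRoot.def, eval_sub, eval_pow, eval_X, sub_eq_zero]
  have hsub : Finset.univ.image (algebraMap F K) ⊆
      (X ^ Fintype.card F - X : K[X]).roots.toFinset := by
    intro y hy
    obtain ⟨a, -, rfl⟩ := Finset.mem_image.1 hy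
    rw [hmem, ← map_pow, FiniteField.pow_card]
  have heq := Finset.eq_of_subset_of_card_le hsub (by
    rw [Finset.card_image_of_injective _ (algebraMap F K).injective, Finset.card_univ]
    refine (Multiset.toFinset_card_le _).trans ((card_roots' _).trans ?_)
    rw [FiniteField.X_pow_card_sub_X_natDegree_eq K hq])
  have := (hmem x).2 hx
  rw [← heq] at this
  obtain ⟨a, -, ha⟩ := Finset.mem_image.1 this
  exact ⟨a, ha⟩

/-- A finite set stable under Frobenius is the set of roots of a monic polynomial over the base
field. -/
theorem exists_monic_map_eq_prod {F K : Type*} [Field F] [Fintype F] [Field K]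
    [Algebra F K] (A : Finset K) (hA : ∀ a ∈ A, a ^ Fintype.card F ∈ A) :
    ∃ g : F[X], g.Monic ∧ g.map (algebraMap F K) = ∏ a ∈ A, (X - C a) ∧ g.natDegree = A.card := by
  classical
  set φ : K →+* K := (FiniteField.frobeniusAlgHom F K).toRingHom with hφ
  have hφa : ∀ a, φ a = a ^ Fintype.card F := fun a => by
    rw [hφ]; simp
  -- Frobenius is injective, so it permutes the stable finite set `A`; it thus fixes the product,
  -- and each coefficient lies in `F`.
  have himg : A.image φ = A := by
    apply Finset.eq_of_subset_of_card_le
    · intro y hy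
      obtain ⟨a, ha, rfl⟩ := Finset.mem_image.1 hy
      rw [hφa]; exact hA a ha
    · rw [Finset.card_image_of_injective _ φ.injective]
  have hmap : (∏ a ∈ A, (X - C a)).map φ = ∏ a ∈ A, (X - C a) := by
    conv_rhs => rw [← himg, Finset.prod_image φ.injective.injOn]
    simp [Polynomial.map_prod]
  have hlift : (∏ a ∈ A, (X - C a)) ∈ lifts (algebraMap F K) := by
    rw [lifts_iff_coeff_lifts]
    intro k
    apply mem_range_algebraMap_of_pow_card_eq_self
    conv_rhs => rw [← hmap]
    rw [coeff_map, hφa]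
  obtain ⟨g, hg, hdeg, hmon⟩ := lifts_and_natDegree_eq_and_monic hlift (monic_prod_X_sub_C _ _)
  exact ⟨g, hmon, hg, by rw [hdeg, natDegree_finsetProd_X_sub_C_eq_card]⟩

section Code

variable {F : Type*} [Field F] {n : ℕ}

theorem wordPoly_add (c d : Fin n → F) : wordPoly (c + d) = wordPoly c + wordPoly d := by
  simp [wordPoly, add_mul, Finset.sum_add_distrib]

theorem wordPoly_smul (a : F) (c : Fin n → F) : wordPoly (a • c) = C a * wordPoly c := by
  simp [wordPoly, Finset.mul_sum, mul_assoc]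

/-- The map sending a word to the class of its polynomial. -/
noncomputable def wordClass (n : ℕ) (g : F[X]) : (Fin n → F) →ₗ[F] AdjoinRoot g where
  toFun c := AdjoinRoot.mk g (wordPoly c)
  map_add' c d := by rw [wordPoly_add, map_add]
  map_smul' a c := by
    rw [wordPoly_smul, map_mul, AdjoinRoot.mk_C, RingHom.id_apply, Algebra.smul_def]
    rfl

theorem mem_ker_wordClass {g : F[X]} {c : Fin n → F} :
    c ∈ LinearMap.ker (wordClass n g) ↔ g ∣ wordPoly c := by
  rw [LinearMap.mem_ker]
  exact AdjoinRoot.mk_eq_zero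

theorem wordClass_surjective {g : F[X]} (hg : g.Monic) (hdeg : g.natDegree ≤ n) :
    Function.Surjective (wordClass n g) := by
  intro y
  obtain ⟨f, rfl⟩ := AdjoinRoot.mk_surjective y
  rcases Nat.eq_zero_or_pos g.natDegree with h0 | h0
  · have : g = 1 := eq_one_of_monic_natDegree_zero hg h0
    refine ⟨0, ?_⟩
    rw [map_zero]
    exact (AdjoinRoot.mk_eq_zero.2 (this ▸ one_dvd f)).symm
  refine ⟨fun i => (f %ₘ g).coeff i, ?_⟩
  change AdjoinRoot.mk g (wordPoly fun i : Fin n => (f %ₘ g).coeff i) = _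
  have hlt : (f %ₘ g).natDegree < n :=
    (natDegree_modByMonic_lt f hg (by rintro rfl; simp at h0)).trans_le hdeg
  have : wordPoly (fun i : Fin n => (f %ₘ g).coeff i) = f %ₘ g := by
    conv_rhs => rw [as_sum_range_C_mul_X_pow' (f %ₘ g) hlt]
    rw [wordPoly, Fin.sum_univ_eq_sum_range (fun i => C ((f %ₘ g).coeff i) * X ^ i) n]
  rw [this, AdjoinRoot.mk_eq_mk]
  refine ⟨-(f /ₘ g), ?_⟩
  have := modByMonic_add_div f g
  linear_combination this

theorem finrank_ker_wordClass {g : F[X]} (hg : g.Monic) (hdeg : g.natDegree ≤ n) :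
    Module.finrank F (LinearMap.ker (wordClass n g)) + g.natDegree = n := by
  have h := LinearMap.finrank_range_add_finrank_ker (wordClass n g)
  rw [LinearMap.range_eq_top.2 (wordClass_surjective hg hdeg), finrank_top,
    (AdjoinRoot.powerBasis' hg).finrank, AdjoinRoot.powerBasis'_dim, Module.finrank_fin_fun] at h
  omega

/-- The difference is `-c_{n-1} (X^n - lam)`: shifting is multiplication by `X` in the quotient. -/
theorem wordPoly_constaShift (lam : F) (c : Fin n → F) :
    X ^ n - C lam ∣ wordPoly (constaShift lam c) - X * wordPoly c := by
  cases n with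
  | zero => simp [wordPoly]
  | succ k =>
    refine ⟨-C (c (Fin.last k)), ?_⟩
    have h1 : wordPoly (constaShift lam c) =
        C lam * C (c (Fin.last k)) + ∑ i : Fin k, C (c i.castSucc) * X ^ ((i : ℕ) + 1) := by
      rw [wordPoly, Fin.sum_univ_succ]
      congr 1
      simp [constaShift, Fin.last]
    have h2 : X * wordPoly c =
        (∑ i : Fin k, C (c i.castSucc) * X ^ ((i : ℕ) + 1)) +
          C (c (Fin.last k)) * X ^ (k + 1) := by
      rw [wordPoly, Fin.sum_univ_castSucc, mul_add, Finset.mul_sum]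
      congr 1
      · refine Finset.sum_congr rfl fun i _ => ?_
        simp only [Fin.val_castSucc]; ring
      · simp only [Fin.val_last]; ring
    rw [h1, h2]
    ring

theorem isConstacyclic_ker_wordClass {lam : F} {g : F[X]} (hg : g ∣ X ^ n - C lam) :
    IsConstacyclic lam (LinearMap.ker (wordClass n g)) := by
  intro c hc
  rw [mem_ker_wordClass] at hc ⊢
  have := dvd_add (hg.trans (wordPoly_constaShift lam c)) (Dvd.dvd.mul_left hc X)
  simpa using this

theorem aeval_wordPoly {K : Type*} [Field K] [Algebra F K] (c : Fin n → F) (x : K) :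
    aeval x (wordPoly c) = ∑ i : Fin n, algebraMap F K (c i) * x ^ (i : ℕ) := by
  simp [wordPoly]

/-- The BCH bound. -/
theorem lt_hammingNorm_of_forall_aeval_eq_zero [DecidableEq F] {K : Type*} [Field K] [Algebra F K]
    {β : K} {r : ℕ} (hβ0 : β ≠ 0) (hβ : IsPrimitiveRoot (β ^ r) n) {κ : ℕ} {c : Fin n → F}
    (hc : c ≠ 0) (h : ∀ k < κ, aeval (β ^ (1 + k * r)) (wordPoly c) = 0) : κ < hammingNorm c := by
  by_contra hle
  rw [not_lt] at hle
  set s : Finset (Fin n) := Finset.univ.filter (fun i => c i ≠ 0) with hs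
  have hcard : s.card ≤ κ := hle
  let e := s.equivFin.symm
  -- Vandermonde on the support: the nodes `(β^r)^e` are distinct, and the vector `c_e β^e` is
  -- killed by at least as many powers as there are nodes.
  have hv := Matrix.eq_zero_of_forall_pow_sum_mul_pow_eq_zero
    (f := fun j : Fin s.card => (β ^ r) ^ ((e j : Fin n) : ℕ))
    (v := fun j => algebraMap F K (c (e j)) * β ^ ((e j : Fin n) : ℕ)) (by
      intro a b hab
      have := hβ.pow_inj (e a : Fin n).isLt (e b : Fin n).isLt hab
      exact e.injective (Subtype.ext (Fin.ext this))) (by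
      intro k
      have hk := h k (k.isLt.trans_le hcard)
      rw [aeval_wordPoly] at hk
      rw [← hk, ← Finset.sum_subset (Finset.subset_univ s)]
      · rw [← Finset.sum_coe_sort s, ← e.sum_comp]
        refine Finset.sum_congr rfl fun j _ => ?_
        ring
      · intro i _ hi
        have : c i = 0 := by simpa [hs] using hi
        rw [this, map_zero, zero_mul])
  apply hc
  funext i
  by_contra hi
  have hi' : i ∈ s := by simpa [hs] using hi
  have := congrFun hv (s.equivFin ⟨i, hi'⟩)
  simp only [e, Equiv.symm_apply_apply, Pi.zero_apply, mul_eq_zero, pow_eq_zero_iff', map_eq_zero]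
    at this
  rcases this with h | h
  · exact hi h
  · exact hβ0 h.1

/-- A nonzero codeword is required, since the infimum of the empty set is 0. -/
theorem le_minDistance [DecidableEq F] {C : Submodule F (Fin n → F)} {d : ℕ}
    (hne : ∃ c ∈ C, c ≠ 0) (h : ∀ c ∈ C, c ≠ 0 → d ≤ hammingNorm c) : d ≤ minDistance C := by
  obtain ⟨c, hc, hc0⟩ := hne
  refine le_csInf ⟨_, c, hc, 0, C.zero_mem, hc0, rfl⟩ ?_
  rintro _ ⟨x, hx, y, hy, hxy, rfl⟩
  rw [hammingDist_comm, hammingDist_eq_hammingNorm]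
  refine h _ ?_ ?_
  · exact C.add_mem (C.neg_mem hy) hx
  · rw [neg_add_eq_sub]; exact sub_ne_zero.2 hxy

theorem pow_eq_pow_iff_of_isPrimitiveRoot {K : Type*} [Field K] {x : K} {M a b : ℕ} (hM : 0 < M)
    (hx : IsPrimitiveRoot x M) : x ^ a = x ^ b ↔ a ≡ b [MOD M] := by
  have hx0 : x ≠ 0 := hx.ne_zero hM.ne'
  wlog h : a ≤ b generalizing a b
  · exact eq_comm.trans ((this (le_of_not_ge h)).trans ⟨Nat.ModEq.symm, Nat.ModEq.symm⟩)
  rw [Nat.modEq_iff_dvd' h, ← hx.pow_eq_one_iff_dvd]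
  obtain ⟨d, rfl⟩ := Nat.exists_eq_add_of_le h
  rw [pow_add, Nat.add_sub_cancel_left, eq_comm, mul_eq_left₀ (pow_ne_zero a hx0)]

/-- A set of indices stable under multiplication by `q` is the defining set of a constacyclic code,
which satisfies the BCH bound. -/
theorem exists_code_of_definingSet [Fintype F] [DecidableEq F] {K : Type*} [Field K] [Algebra F K]
    {r : ℕ} (hr : 0 < r) (hn : 0 < n) {lam : F} {β : K} (hβ : IsPrimitiveRoot β (n * r))
    (hlam : algebraMap F K lam = β ^ n) {T : Finset ℕ} (hT : T ⊆ indexSet n r)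
    (hTq : ∀ i ∈ T, ∃ k ∈ T, k ≡ i * Fintype.card F [MOD n * r]) (hcard : T.card < n) :
    ∃ C : Submodule F (Fin n → F), IsConstacyclic lam C ∧ HasDefiningSet lam r β C T ∧
      Module.finrank F C + T.card = n ∧
      ∀ κ, (∀ k < κ, 1 + k * r ∈ T) → κ + 1 ≤ minDistance C := by
  classical
  have hM : 0 < n * r := Nat.mul_pos hn hr
  have hβ0 : β ≠ 0 := hβ.ne_zero hM.ne'
  have hpow : ∀ a b, β ^ a = β ^ b ↔ a ≡ b [MOD n * r] := fun a b =>
    pow_eq_pow_iff_of_isPrimitiveRoot hM hβ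
  have hinj : Set.InjOn (fun i => β ^ i) (indexSet n r) := by
    intro a ha b hb hab
    have hab := (hpow a b).1 hab
    obtain ⟨⟨ha1, ha2⟩, -⟩ := (mem_indexSet_iff_modEq hr).1 ha
    obtain ⟨⟨hb1, hb2⟩, -⟩ := (mem_indexSet_iff_modEq hr).1 hb
    rcases le_total a b with h | h
    · have := Nat.eq_zero_of_dvd_of_lt ((Nat.modEq_iff_dvd' h).1 hab) (by omega)
      omega
    · have := Nat.eq_zero_of_dvd_of_lt ((Nat.modEq_iff_dvd' h).1 hab.symm) (by omega)
      omega
  obtain ⟨g, hmon, hmap, hdeg⟩ := exists_monic_map_eq_prod (F := F) (T.image (fun i => β ^ i)) (by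
    intro a ha
    obtain ⟨i, hi, rfl⟩ := Finset.mem_image.1 ha
    obtain ⟨k, hk, hki⟩ := hTq i hi
    refine Finset.mem_image.2 ⟨k, hk, ?_⟩
    rw [← pow_mul]
    exact (hpow _ _).2 hki)
  have hroot : ∀ x : K, aeval x g = 0 ↔ ∃ i ∈ T, β ^ i = x := by
    intro x
    rw [aeval_def, eval₂_eq_eval_map, hmap, eval_prod, Finset.prod_eq_zero_iff]
    simp only [Finset.mem_image, eval_sub, eval_X, eval_C, sub_eq_zero]
    constructor
    · rintro ⟨_, h, rfl⟩; exact h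
    · intro h; exact ⟨x, h, rfl⟩
  have hdvd : g ∣ X ^ n - C lam := by
    rw [← map_dvd_map' (algebraMap F K), hmap]
    refine Finset.prod_dvd_of_coprime ?_ ?_
    · intro a _ b _ hab
      exact isCoprime_X_sub_C_of_isUnit_sub (sub_ne_zero.2 hab).isUnit
    · intro a ha
      obtain ⟨i, hi, rfl⟩ := Finset.mem_image.1 ha
      rw [dvd_iff_isRoot]
      obtain ⟨k, -, rfl⟩ := mem_indexSet.1 (hT hi)
      simp only [Polynomial.map_sub, Polynomial.map_pow, map_X, map_C, IsRoot.def, eval_sub,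
        eval_pow, eval_X, eval_C, hlam, sub_eq_zero]
      rw [← pow_mul, hpow, Nat.ModEq, show (1 + k * r) * n = n + n * r * k by ring,
        Nat.add_mul_mod_self_left]
  have hdegT : g.natDegree = T.card := by
    rw [hdeg, Finset.card_image_of_injOn (hinj.mono hT)]
  have hfin := finrank_ker_wordClass hmon (n := n) (by omega)
  rw [hdegT] at hfin
  refine ⟨LinearMap.ker (wordClass n g), isConstacyclic_ker_wordClass hdvd,
    ⟨g, ⟨hmon, hdvd, fun c => mem_ker_wordClass⟩, fun i => ?_⟩, hfin, fun κ hκ => ?_⟩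
  · rw [hroot]
    constructor
    · exact fun hi => ⟨hT hi, i, hi, rfl⟩
    · rintro ⟨hi, k, hk, hki⟩
      rwa [← hinj (hT hk) hi hki]
  · refine le_minDistance ?_ fun c hc hc0 => ?_
    -- The dimension `n - |T|` is positive.
    · obtain ⟨c, hc, h⟩ := Submodule.exists_mem_ne_zero_of_ne_bot
        (p := LinearMap.ker (wordClass n g)) (by
          intro h
          rw [h, finrank_bot] at hfin
          omega)
      exact ⟨c, hc, h⟩
    · refine lt_hammingNorm_of_forall_aeval_eq_zero hβ0 (hβ.pow hM (mul_comm n r)) hc0 fun k hk => ?_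
      obtain ⟨f, hf⟩ := mem_ker_wordClass.1 hc
      rw [hf, map_mul, (hroot _).2 ⟨_, hκ k hk, rfl⟩, zero_mul]

theorem exists_orderOf_eq_of_dvd [Fintype F] {r : ℕ} (hr : r ∣ Fintype.card F - 1) :
    ∃ lam : F, orderOf lam = r := by
  classical
  obtain ⟨g, hg⟩ := IsCyclic.exists_ofOrder_eq_natCard (α := Fˣ)
  rw [Nat.card_eq_fintype_card, Fintype.card_units] at hg
  obtain ⟨k, hk⟩ := hr
  have hpos : 0 < Fintype.card F - 1 := Nat.sub_pos_of_lt Fintype.one_lt_card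
  have hk0 : k ≠ 0 := by rintro rfl; omega
  refine ⟨(g ^ k : Fˣ), ?_⟩
  rw [orderOf_units, orderOf_pow_of_dvd hk0 (by rw [hg, hk]; exact dvd_mul_left _ _), hg, hk,
    Nat.mul_div_cancel _ (Nat.pos_of_ne_zero hk0)]

/-- For any primitive `n r`-th root `β`, both `β^n` and `lam` are primitive `r`-th roots of unity,
so `lam = (β^n)^i` with `i` coprime to `r`. Lifting `i` to a unit modulo `n r` corrects `β`. -/
theorem exists_isPrimitiveRoot_pow_eq [Fintype F] {r : ℕ}
    (hM : (Fintype.card F).Coprime (n * r)) (hM0 : 0 < n * r) {lam : F} (hlam : orderOf lam = r) :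
    ∃ β : AlgebraicClosure F, IsPrimitiveRoot β (n * r) ∧ algebraMap F _ lam = β ^ n := by
  have : NeZero (n * r) := ⟨hM0.ne'⟩
  have : NeZero r := ⟨(Nat.pos_of_mul_pos_left hM0).ne'⟩
  have : NeZero ((n * r : ℕ) : F) := ⟨by
    obtain ⟨p, _, k, hp, hk⟩ := FiniteField.card' F
    rw [Ne, CharP.cast_eq_zero_iff F p]
    intro h
    rw [hk] at hM
    exact hp.one_lt.ne' (Nat.dvd_one.1
      (hM.gcd_eq_one ▸ Nat.dvd_gcd (dvd_pow_self p k.ne_zero) h))⟩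
  obtain ⟨β, hβ⟩ := HasEnoughRootsOfUnity.exists_primitiveRoot (AlgebraicClosure F) (n * r)
  have hl : IsPrimitiveRoot (algebraMap F (AlgebraicClosure F) lam) r :=
    (hlam ▸ IsPrimitiveRoot.orderOf lam).map_of_injective (algebraMap F _).injective
  have hn := hβ.pow hM0 rfl
  obtain ⟨i, -, hi, hil⟩ := hn.isPrimitiveRoot_iff.1 hl
  obtain ⟨u, hu⟩ := ZMod.unitsMap_surjective (dvd_mul_left r n) (ZMod.unitOfCoprime i hi)
  refine ⟨β ^ (u : ZMod (n * r)).val, hβ.pow_of_coprime _ (ZMod.val_coe_unit_coprime u), ?_⟩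
  rw [← hil, ← pow_mul β _ n, mul_comm _ n, pow_mul,
    pow_eq_pow_iff_of_isPrimitiveRoot (Nat.pos_of_mul_pos_left hM0) hn,
    ← ZMod.natCast_eq_natCast_iff]
  have := congrArg (fun x : (ZMod r)ˣ => (x : ZMod r)) hu
  simp only [ZMod.unitsMap_val, ZMod.coe_unitOfCoprime] at this
  rw [← this, ZMod.natCast_val]

end Code

/-! ### Rounding -/

theorem ceil_div_natCast {d : ℕ} (hd : 0 < d) (k : ℕ) :
    ⌈(k : ℚ) / d⌉ = ((k + (d - 1)) / d : ℕ) := by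
  have hd' : (0 : ℚ) < d := by exact_mod_cast hd
  have h1 := Nat.div_mul_le_self (k + (d - 1)) d
  have h2 := Nat.lt_div_mul_add (a := k + (d - 1)) hd
  rw [Int.ceil_eq_iff, lt_div_iff₀ hd', div_le_iff₀ hd']
  generalize (k + (d - 1)) / d = e at *
  constructor
  · have : e * d < k + d := by omega
    have : (e * d : ℚ) < k + d := by exact_mod_cast this
    push_cast
    linarith
  · have : k ≤ e * d := by omega
    exact_mod_cast this

theorem ceil_mul_div_sub_one {q : ℕ} (hq : 2 ≤ q) (k : ℕ) :
    ⌈(q : ℚ) * k / ((q : ℚ) - 1)⌉ = (k + (k + (q - 2)) / (q - 1) : ℕ) := by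
  have h1 : ((q - 1 : ℕ) : ℚ) = (q : ℚ) - 1 := by
    rw [Nat.cast_sub (by omega), Nat.cast_one]
  have h0 : ((q - 1 : ℕ) : ℚ) ≠ 0 := Nat.cast_ne_zero.2 (by omega)
  have h2 : (q : ℚ) * k / ((q : ℚ) - 1) = k + (k : ℚ) / ((q - 1 : ℕ) : ℚ) := by
    rw [← h1]
    field_simp
    rw [h1]
    ring
  rw [h2, Int.ceil_natCast_add, ceil_div_natCast (by omega), Nat.sub_sub]
  push_cast
  rfl

theorem ceil_half (N : ℕ) : ⌈(N : ℚ) / 2⌉ = ((N + 1) / 2 : ℕ) := by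
  simpa using ceil_div_natCast (d := 2) (by norm_num) N

theorem natCeil_half (N : ℕ) : ⌈(N : ℚ) / 2⌉₊ = (N + 1) / 2 := by
  rw [← Int.ceil_toNat, ceil_half, Int.toNat_natCast]

theorem floor_half (N : ℕ) : ⌊(N : ℚ) / 2⌋ = (N / 2 : ℕ) := by
  exact_mod_cast Rat.floor_natCast_div_natCast N 2

theorem natFloor_half (N : ℕ) : ⌊(N : ℚ) / 2⌋₊ = N / 2 := by
  exact_mod_cast Nat.floor_div_eq_div (K := ℚ) N 2

/-- Solves the counting inequality for `κ`: the left side of the conclusion is `⌈q A / (q - 1)⌉ -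
1`. -/
theorem add_div_le_of_add_div_le {q A κ : ℕ} (hq : 2 ≤ q) (hA : 1 ≤ A) (h : A + κ / q ≤ κ) :
    A + (A - 1) / (q - 1) ≤ κ := by
  obtain ⟨d, rfl⟩ : ∃ d, q = d + 1 := ⟨q - 1, by omega⟩
  have h1 := Nat.lt_div_mul_add (a := κ) (show 0 < d + 1 by omega)
  rw [Nat.add_sub_cancel]
  suffices (A - 1) / d ≤ κ / (d + 1) by omega
  rw [← Nat.lt_succ_iff, Nat.div_lt_iff_lt_mul (by omega)]
  generalize κ / (d + 1) = f at *
  rw [Nat.succ_mul]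
  rw [mul_add] at h1
  omega

theorem add_pred_div {k d : ℕ} (hd : 0 < d) (hk : 1 ≤ k) : (k + (d - 1)) / d = (k - 1) / d + 1 := by
  rw [← Nat.add_div_right _ hd]
  congr 1
  omega

/-! ### Triples -/

/-- Clearing the denominator in the bound on `t` says that `1 + (q t + j) q^(m-i)`, which is
`q^(m-i)` times `q^i + q t + j` modulo `q^m - 1`, is the smaller number. -/
theorem of_mem_tripleSet {q m s r N i j t : ℕ} (hq : 2 ≤ q) (hs : 0 < s)
    (h : (i, j, t) ∈ tripleSet q m s r N) :
    i < m ∧ m + 1 ≤ 2 * i ∧ 1 ≤ j ∧ j < q ∧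
      1 + (q * t + j) * q ^ (m - i) < q ^ i + q * t + j ∧ q ^ i + q * t + j ≡ 1 [MOD r] ∧
      ((q ^ i + q * t + j : ℕ) : ℤ) ≤
        1 + (⌈(q : ℚ) * (⌈(N : ℚ) / 2⌉ : ℚ) / ((q : ℚ) - 1)⌉ - 2) * (r : ℤ) := by
  obtain ⟨h1, h2, h3, h4, h5, h6, h7⟩ := h
  have hq1 : (1 : ℝ) < q := by exact_mod_cast hq
  have him : i < m := by
    have hlog : 0 < Real.logb q ((s : ℝ) + 1) :=
      Real.logb_pos hq1 (by have : (0 : ℝ) < s := by exact_mod_cast hs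
                            linarith)
    have h8 : ((i : ℤ) : ℝ) ≤ (m : ℝ) - Real.logb q ((s : ℝ) + 1) := Int.le_floor.1 h2
    have : (i : ℝ) < m := by push_cast at h8; linarith
    exact_mod_cast this
  refine ⟨him, ?_, h3, by omega, ?_, h6, h7⟩
  · have : (m : ℝ) + 1 ≤ 2 * i := by linarith
    exact_mod_cast this
  · have he : (1 : ℝ) < (q : ℝ) ^ (m - i) := one_lt_pow₀ hq1 (by omega)
    have hpos : (0 : ℝ) < (q : ℝ) ^ (m - i + 1) - q := by
      rw [pow_succ]; nlinarith
    rw [lt_div_iff₀ hpos, pow_succ] at h5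
    have : (1 : ℝ) + (q * t + j) * (q : ℝ) ^ (m - i) < (q : ℝ) ^ i + q * t + j := by linarith
    exact_mod_cast this

/-- The bound on `t` gives `q t + j < q^i`, so `i` is the integer logarithm of the value, and `j` is
its residue modulo `q`. -/
theorem injOn_tripleSet {q m s r N : ℕ} (hq : 2 ≤ q) (hs : 0 < s) :
    Set.InjOn (fun x : ℕ × ℕ × ℕ => q ^ x.1 + q * x.2.2 + x.2.1) (tripleSet q m s r N) := by
  have key : ∀ {i j t : ℕ}, (i, j, t) ∈ tripleSet q m s r N →
      j < q ∧ Nat.log q (q ^ i + q * t + j) = i := by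
    intro i j t h
    obtain ⟨h1, h2, h3, h4, h5, -⟩ := of_mem_tripleSet hq hs h
    refine ⟨h4, ?_⟩
    have he : 2 ≤ q ^ (m - i) := hq.trans (Nat.le_self_pow (by omega) q)
    have h6 : (q * t + j) * 2 ≤ (q * t + j) * q ^ (m - i) := Nat.mul_le_mul_left _ he
    have h7 : q ^ i * 2 ≤ q ^ i * q := Nat.mul_le_mul_left _ hq
    refine Nat.log_eq_of_pow_le_of_lt_pow (by omega) ?_
    rw [pow_succ]
    omega
  rintro ⟨i, j, t⟩ h ⟨i', j', t'⟩ h' heq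
  simp only at heq
  obtain ⟨hj, hi⟩ := key h
  obtain ⟨hj', hi'⟩ := key h'
  have hii : i = i' := by rw [← hi, ← hi', heq]
  subst hii
  have heq : q * t + j = q * t' + j' := by omega
  have hjj : j = j' := by
    have := congrArg (· % q) heq
    simpa [Nat.mul_add_mod, Nat.mod_eq_of_lt, hj, hj'] using this
  subst hjj
  have : t = t' := Nat.eq_of_mul_eq_mul_left (show 0 < q by omega) (by omega)
  rw [this]

/-- The triples give elements of `Z_{n,r}` that are neither leaders nor multiples of `q`. -/
theorem not_leader_of_mem_tripleSet {q n m s r N i j t l : ℕ} (hq : 2 ≤ q) (hs : 0 < s)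
    (hm : q ^ m ≡ 1 [MOD n * r]) (h : (i, j, t) ∈ tripleSet q m s r N)
    (hle : q ^ i + q * t + j ≤ n * r) :
    ¬ q ∣ q ^ i + q * t + j ∧ q ^ i + q * t + j ∉ cosetLeaders q n r l := by
  obtain ⟨h1, h2, h3, h4, h5, -⟩ := of_mem_tripleSet hq hs h
  constructor
  · rw [Nat.dvd_add_right]
    · exact Nat.not_dvd_of_pos_of_lt h3 h4
    · exact dvd_add (dvd_pow_self q (by omega)) (dvd_mul_right _ _)
  · intro hl
    refine absurd ((Finset.mem_filter.1 hl).2.2 (1 + (q * t + j) * q ^ (m - i))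
      (mem_cyclotomicCoset.2 ⟨⟨by omega, by omega⟩, m - i, ?_⟩)) (not_le.2 h5)
    have h6 : (q ^ i + q * t + j) * q ^ (m - i) = q ^ m + (q * t + j) * q ^ (m - i) := by
      rw [add_assoc, add_mul, ← pow_add, Nat.add_sub_cancel' h1.le]
    rw [h6]
    exact (hm.symm).add_right _

/-- The count is applied twice: without triples it gives `κ ≥ ⌈q k / (q - 1)⌉ - 1`, which places
every triple value below `1 + κ r`; then the triples themselves can be counted. -/
theorem ncard_tripleSet_add_le {q n m s r N l k κ : ℕ} (hr : 0 < r) (hq : 2 ≤ q) (hrq : r ∣ q - 1)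
    (hs : 0 < s) (hm0 : 0 < m) (hm : q ^ m ≡ 1 [MOD n * r]) (hN : 1 ≤ (N + 1) / 2)
    (hκ : 1 + κ * r ∈ cosetLeaders q n r l)
    (hk : ((cosetLeaders q n r l).filter (fun j => j < 1 + κ * r)).card = k)
    (hkN : k = (N + 1) / 2) :
    k + (tripleSet q m s r N).ncard + κ / q ≤ κ := by
  have h0 := card_add_card_add_div_le (κ := κ) (l := l) (D := ∅) hr hq hrq hm0 hm (by simp)
  rw [hk, Finset.card_empty, add_zero] at h0
  have h1 := add_div_le_of_add_div_le hq (by omega) h0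
  have hκn := ((mem_indexSet_iff_modEq hr).1 (mem_indexSet_of_mem_cosetLeaders hκ)).1.2
  classical
  set D : Finset ℕ := (Finset.Icc 1 (κ * r)).filter
    (fun x => x ≡ 1 [MOD r] ∧ ¬ q ∣ x ∧ x ∉ cosetLeaders q n r l) with hD
  have hS : (tripleSet q m s r N).ncard ≤ D.card := by
    rw [← Set.ncard_coe_finset]
    refine Set.ncard_le_ncard_of_injOn _ ?_ (injOn_tripleSet hq hs) D.finite_toSet
    rintro ⟨i, j, t⟩ h
    obtain ⟨-, -, h3, -, -, h6, h7⟩ := of_mem_tripleSet hq hs h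
    rw [ceil_half, Int.cast_natCast, ceil_mul_div_sub_one hq, ← hkN] at h7
    have h8 : q ^ i + q * t + j ≤ κ * r := by
      have h9 : k + (k + (q - 2)) / (q - 1) ≤ κ + 1 := by
        have := add_pred_div (k := k) (show 0 < q - 1 by omega) (by omega)
        rw [Nat.sub_sub] at this
        simp only [Nat.reduceAdd] at this
        omega
      have h10 : (((k + (k + (q - 2)) / (q - 1) : ℕ) : ℤ) - 2) * r ≤ ((κ : ℤ) - 1) * r :=
        mul_le_mul_of_nonneg_right (by omega) (by omega)
      have h11 : (1 : ℤ) ≤ r := by exact_mod_cast hr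
      have : ((q ^ i + q * t + j : ℕ) : ℤ) ≤ κ * r := by linarith
      exact_mod_cast this
    obtain ⟨h12, h13⟩ := not_leader_of_mem_tripleSet (l := l) hq hs hm h (by omega)
    simp only [hD, Finset.coe_filter, Finset.mem_Icc, Set.mem_ofPred_eq]
    exact ⟨⟨by omega, h8⟩, h6, h12, h13⟩
  have h2 := card_add_card_add_div_le (κ := κ) (l := l) (D := D) hr hq hrq hm0 hm (by
    intro x hx
    obtain ⟨hx1, hx2, hx3, hx4⟩ := Finset.mem_filter.1 hx
    obtain ⟨hx5, hx6⟩ := Finset.mem_Icc.1 hx1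
    exact ⟨hx2, hx5, by omega, hx3, hx4⟩)
  omega

/-! ### The two families of codes -/

section Main

variable {F : Type*} [Field F] [Fintype F] [DecidableEq F] {p c q r n N : ℕ}

theorem ceilHalf_eq (hsz : cosetSizes q n r = {p, p ^ (c + 1)}) (h1 : numCosets q n r p = 1)
    (hN : numCosets q n r (p ^ (c + 1)) = N) :
    ceilHalf q n r = firstCosets q n r p 1 ∪ firstCosets q n r (p ^ (c + 1)) ((N + 1) / 2) := by
  rw [ceilHalf, hsz, Finset.biUnion_insert, Finset.singleton_biUnion, h1, hN, natCeil_half,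
    natCeil_half]

/-- The single coset of size `p` drops out, because `⌊1/2⌋ = 0`. -/
theorem floorHalf_eq (hsz : cosetSizes q n r = {p, p ^ (c + 1)}) (h1 : numCosets q n r p = 1)
    (hN : numCosets q n r (p ^ (c + 1)) = N) :
    floorHalf q n r = firstCosets q n r (p ^ (c + 1)) (N / 2) := by
  rw [floorHalf, hsz, Finset.biUnion_insert, Finset.singleton_biUnion, h1, hN, natFloor_half,
    natFloor_half]
  simp [firstCosets]

theorem exists_code_ceilHalf (hF : Fintype.card F = q) (hp : p.Prime) (hr0 : 0 < r)
    (hr : r ∣ q - 1) (hpq : p ∣ q - 1) (hpr : ¬ p ∣ (q - 1) / r) (hc : 1 ≤ c)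
    (hn : n = codeLength p (c + 1) q) (hN : N = numCosets q n r (p ^ (c + 1)))
    {lam : F} {K : Type*} [Field K] [Algebra F K] {β : K} (hβ : IsPrimitiveRoot β (n * r))
    (hlam : algebraMap F K lam = β ^ n) :
    ∃ C : Submodule F (Fin n → F), IsConstacyclic lam C ∧
      HasDefiningSet lam r β C (ceilHalf q n r) ∧
      Module.finrank F C + (p + p ^ (c + 1) * ((N + 1) / 2)) = n ∧
      ⌈(q : ℚ) * (⌈(N : ℚ) / 2⌉ : ℚ) / ((q : ℚ) - 1)⌉ +
        lambdaTerm q (p ^ (c + 1)) ((q ^ p ^ c - 1) / r) r N ≤ (minDistance C : ℤ) := by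
  have hq : 2 ≤ q := hF ▸ Fintype.one_lt_card
  obtain ⟨hsz, hN1, hNn, hN2⟩ := coset_counts hp hq hr0 hr hpq hpr hc
  have hm := pow_modEq_one_codeLength_mul (c := c) hp hq hr
  have hn0 := codeLength_succ_pos (c := c) hp hq
  rw [← hn] at hsz hN1 hNn hN2 hm hn0
  rw [← hN] at hNn hN2
  have hm0 : 0 < p ^ (c + 1) := pow_pos hp.pos _
  have hq1 := modEq_one_of_dvd_sub_one (by omega) hr
  have hpp : p < p ^ (c + 1) := by
    simpa using Nat.pow_lt_pow_right hp.one_lt (show 1 < c + 1 by omega)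
  have hs : 0 < (q ^ p ^ c - 1) / r := by
    have h1 : q ≤ q ^ p ^ c := Nat.le_self_pow (pow_pos hp.pos _).ne' q
    have h2 := Nat.le_of_dvd (by omega) hr
    exact Nat.div_pos (by omega) hr0
  have hkN : (N + 1) / 2 < N := by omega
  have hk1 : 1 ≤ (N + 1) / 2 := by omega
  rw [ceilHalf_eq hsz hN1 hN.symm]
  generalize hk : (N + 1) / 2 = k at *
  have hcard : (firstCosets q n r p 1 ∪ firstCosets q n r (p ^ (c + 1)) k).card =
      p + p ^ (c + 1) * k := by
    rw [Finset.card_union_of_disjoint, card_firstCosets hr0 hq1 hm0 hm (by omega),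
      card_firstCosets hr0 hq1 hm0 hm (by omega)]
    · ring
    · rw [Finset.disjoint_left]
      intro x hx hx'
      have h1 := card_of_mem_firstCosets hm0 hm hx
      have h2 := card_of_mem_firstCosets hm0 hm hx'
      omega
  have hlt : k * p ^ (c + 1) < N * p ^ (c + 1) := Nat.mul_lt_mul_of_pos_right hkN hm0
  obtain ⟨C, hC, hdef, hfin, hdist⟩ := exists_code_of_definingSet hr0 hn0 hβ hlam
    (T := firstCosets q n r p 1 ∪ firstCosets q n r (p ^ (c + 1)) k)
    (Finset.union_subset (firstCosets_subset hr0 hq1 _ _) (firstCosets_subset hr0 hq1 _ _))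
    (by
      rw [hF]
      intro i hi
      rcases Finset.mem_union.1 hi with h | h
      · obtain ⟨y, hy, hyi⟩ := exists_mem_firstCosets_modEq_mul (Nat.mul_pos hn0 hr0) hm0 hm h
        exact ⟨y, Finset.mem_union_left _ hy, hyi⟩
      · obtain ⟨y, hy, hyi⟩ := exists_mem_firstCosets_modEq_mul (Nat.mul_pos hn0 hr0) hm0 hm h
        exact ⟨y, Finset.mem_union_right _ hy, hyi⟩)
    (by rw [hcard, mul_comm]; omega)
  rw [hcard] at hfin
  refine ⟨C, hC, hdef, hfin, ?_⟩
  obtain ⟨κ, hκ, hκk, hrun⟩ := exists_leader_threshold hr0 hq1 hm0 hm (hN ▸ hkN)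
  obtain ⟨κ', hκ', hκκ⟩ := mem_indexSet.1 (mem_indexSet_of_mem_cosetLeaders hκ)
  have hκn : κ < n := by
    rwa [← Nat.eq_of_mul_eq_mul_right hr0 (Nat.add_left_cancel hκκ)]
  have hd := hdist κ (fun i hi => by
    have hiZ : 1 + i * r ∈ indexSet n r := mem_indexSet.2 ⟨i, by omega, rfl⟩
    have hmem : (cyclotomicCoset q (n * r) (1 + i * r)).card ∈ cosetSizes q n r :=
      Finset.mem_image_of_mem _ hiZ
    rw [hsz, Finset.mem_insert, Finset.mem_singleton] at hmem
    rcases hmem with h | h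
    · refine Finset.mem_union_left _ ?_
      have hfull := firstCosets_numCosets hr0 hq1 hm0 hm p
      rw [hN1] at hfull
      rw [hfull]
      exact Finset.mem_filter.2 ⟨hiZ, h⟩
    · refine Finset.mem_union_right _ (hrun _ hiZ h ?_)
      have := Nat.mul_lt_mul_of_pos_right hi hr0
      omega)
  have hS := ncard_tripleSet_add_le (N := N) hr0 hq hr hs hm0 hm (by omega) hκ hκk hk.symm
  rw [ceil_half, hk, Int.cast_natCast, ceil_mul_div_sub_one hq, lambdaTerm,
    ceil_mul_div_sub_one hq]
  generalize (tripleSet q (p ^ (c + 1)) ((q ^ p ^ c - 1) / r) r N).ncard = S at *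
  have h1 := add_div_le_of_add_div_le hq (by omega) hS
  obtain ⟨d, rfl⟩ : ∃ d, q = d + 1 := ⟨q - 1, by omega⟩
  -- The separate ceilings for `k` and `S` exceed the ceiling for `k + S` by at most 1, which the
  -- `-1` in `lambdaTerm` absorbs.
  have h2 := add_pred_div (show 0 < d by omega) hk1
  have h3 : (k - 1) / d + (S + (d - 1)) / d ≤ (k - 1 + (S + (d - 1))) / d :=
    Nat.div_add_div_le_add_div
  have h5 : (k - 1 + (S + (d - 1))) / d ≤ (k + S - 1) / d + 1 := by
    rw [← Nat.add_div_right _ (show 0 < d by omega)]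
    exact Nat.div_le_div_right (by omega)
  simp only [Nat.add_sub_cancel, show d + 1 - 2 = d - 1 by omega] at *
  omega

theorem exists_code_floorHalf (hF : Fintype.card F = q) (hp : p.Prime) (hr0 : 0 < r)
    (hr : r ∣ q - 1) (hpq : p ∣ q - 1) (hpr : ¬ p ∣ (q - 1) / r) (hc : 1 ≤ c)
    (hn : n = codeLength p (c + 1) q) (hN : N = numCosets q n r (p ^ (c + 1)))
    (hcond : r ≤ 3 ∨ q * r ≤ 2 * p ^ c * (q - 1))
    {lam : F} {K : Type*} [Field K] [Algebra F K] {β : K} (hβ : IsPrimitiveRoot β (n * r))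
    (hlam : algebraMap F K lam = β ^ n) :
    ∃ C : Submodule F (Fin n → F), IsConstacyclic lam C ∧
      HasDefiningSet lam r β C (floorHalf q n r) ∧
      Module.finrank F C + p ^ (c + 1) * (N / 2) = n ∧
      ⌊(q : ℚ) * N / (2 * ((q : ℚ) - 1))⌋ ≤ (minDistance C : ℤ) := by
  have hq : 2 ≤ q := hF ▸ Fintype.one_lt_card
  have hpr' := prime_dvd_of_not_dvd_div hp hr hpq hpr
  obtain ⟨hsz, hN1, hNn, hN2⟩ := coset_counts hp hq hr0 hr hpq hpr hc
  obtain ⟨n', hn', hmod, hcop⟩ := exists_cofactor hp hq hr hpq hpr' hc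
  have hsize := fun i hi => card_cyclotomicCoset_codeLength (i := i) hp hq hr0 hr hpq hpr
    hn' hcop hi
  have hm := pow_modEq_one_codeLength_mul (c := c) hp hq hr
  have hn0 := codeLength_succ_pos (c := c) hp hq
  rw [← hn] at hsz hN1 hNn hN2 hm hn0 hn' hsize
  rw [← hN] at hNn hN2
  have hm0 : 0 < p ^ (c + 1) := pow_pos hp.pos _
  have hq1 := modEq_one_of_dvd_sub_one (by omega) hr
  have hq3 : 3 ≤ q := by
    have := Nat.le_of_dvd (by omega) hpq
    have := hp.two_le
    omega
  have hcond' : q * r ≤ 2 * p ^ c * (q - 1) := by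
    rcases hcond with h3 | h
    -- A prime `p` dividing `r ≤ 3` equals `r`, so the second alternative holds anyway.
    · have hpr3 : p = r := by
        obtain ⟨a, rfl⟩ := hpr'
        have := hp.two_le
        have : a < 2 := by
          by_contra h
          have : p * 2 ≤ p * a := Nat.mul_le_mul_left _ (not_lt.1 h)
          omega
        have : a = 1 := by
          have : 0 < a := Nat.pos_of_mul_pos_left hr0
          omega
        rw [this, mul_one]
      have h1 : r ≤ p ^ c := hpr3 ▸ Nat.le_self_pow (by omega) p
      calc q * r ≤ (2 * (q - 1)) * p ^ c := Nat.mul_le_mul (by omega) h1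
        _ = _ := by ring
    · exact h
  rw [floorHalf_eq hsz hN1 hN.symm]
  have hkN : N / 2 < N := by omega
  have hN2k : N ≤ 2 * (N / 2) + 1 := by omega
  have hk1 : 1 ≤ N / 2 := by omega
  generalize hk : N / 2 = k at *
  have hcard : (firstCosets q n r (p ^ (c + 1)) k).card = p ^ (c + 1) * k := by
    rw [card_firstCosets hr0 hq1 hm0 hm (by omega), mul_comm]
  have hlt : k * p ^ (c + 1) < N * p ^ (c + 1) := Nat.mul_lt_mul_of_pos_right hkN hm0
  obtain ⟨C, hC, hdef, hfin, hdist⟩ := exists_code_of_definingSet hr0 hn0 hβ hlam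
    (T := firstCosets q n r (p ^ (c + 1)) k) (firstCosets_subset hr0 hq1 _ _)
    (by
      rw [hF]
      exact fun i hi => exists_mem_firstCosets_modEq_mul (Nat.mul_pos hn0 hr0) hm0 hm hi)
    (by rw [hcard, mul_comm]; omega)
  rw [hcard] at hfin
  refine ⟨C, hC, hdef, hfin, ?_⟩
  obtain ⟨κ, hκ, hκk, hrun⟩ := exists_leader_threshold hr0 hq1 hm0 hm (hN ▸ hkN)
  obtain ⟨κ', hκ', hκκ⟩ := mem_indexSet.1 (mem_indexSet_of_mem_cosetLeaders hκ)
  have hκn : κ < n := by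
    rwa [← Nat.eq_of_mul_eq_mul_right hr0 (Nat.add_left_cancel hκκ)]
  have hn'0 : 1 ≤ n' := Nat.pos_of_mul_pos_left (hn' ▸ hn0 : 0 < p * n')
  -- `n' = 1 + k₀ r` is the least index whose coset has size `p`, so the run is safe up to `min κ
  -- k₀`.
  obtain ⟨k₀, hk₀⟩ := (Nat.modEq_iff_dvd' hn'0).1 hmod.symm
  have hd := hdist (min κ k₀) (fun i hi => by
    obtain ⟨hi1, hi2⟩ := lt_min_iff.1 hi
    have hiZ : 1 + i * r ∈ indexSet n r := mem_indexSet.2 ⟨i, by omega, rfl⟩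
    refine hrun _ hiZ ?_ ?_
    · rw [hsize _ ((mem_indexSet_iff_modEq hr0).1 hiZ).2, if_neg]
      apply Nat.not_dvd_of_pos_of_lt (by omega)
      have := Nat.mul_lt_mul_of_pos_right hi2 hr0
      rw [mul_comm k₀] at this
      omega
    · have := Nat.mul_lt_mul_of_pos_right hi1 hr0
      omega)
  have hS := card_add_card_add_div_le (κ := κ) (l := p ^ (c + 1)) (D := ∅) hr0 hq hr hm0 hm
    (by simp)
  rw [hκk, Finset.card_empty, add_zero] at hS
  have h1 := add_div_le_of_add_div_le hq hk1 hS
  obtain ⟨d, rfl⟩ : ∃ d, q = d + 1 := ⟨q - 1, by omega⟩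
  rw [Nat.add_sub_cancel] at h1 hcond'
  have hd0 : 0 < d := by omega
  -- Equivalent to `q N / (2 (q - 1)) < min κ k₀ + 2`. When `κ` is the minimum and `N` is odd,
  -- strictness relies on `q ≥ 3`.
  have hmain : (d + 1) * N < (min κ k₀ + 2) * (2 * d) := by
    rcases le_total κ k₀ with h | h
    · rw [min_eq_left h]
      have h2 := Nat.lt_div_mul_add (a := k - 1) hd0
      have h3 : (k + (k - 1) / d) * d ≤ κ * d := Nat.mul_le_mul_right _ h1
      rw [add_mul] at h3
      have h4 : (d + 1) * N ≤ (d + 1) * (2 * k + 1) := Nat.mul_le_mul_left _ hN2k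
      have h5 : k * d + k ≤ κ * d + d := by omega
      have h6 : (d + 1) * (2 * k + 1) = 2 * (k * d + k) + d + 1 := by ring
      have h7 : (κ + 2) * (2 * d) = 2 * (κ * d + d) + 2 * d := by ring
      omega
    · rw [min_eq_right h]
      -- From `p (n' - 1) = n - p = N p^(c+1)`; with this value the condition on `r` reads `q N ≤ 2
      -- (q - 1) k₀`.
      have h2 : k₀ * r = N * p ^ c := by
        have : p * (k₀ * r) = p * (N * p ^ c) := by
          have h3 : p * n' = p * (1 + k₀ * r) := by rw [mul_comm k₀]; congr 1; omega
          have h4 : p * (N * p ^ c) = N * p ^ (c + 1) := by ring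
          rw [h4]
          rw [mul_add] at h3
          omega
        exact Nat.eq_of_mul_eq_mul_left hp.pos this
      have h3 : (d + 1) * N * r ≤ k₀ * (2 * d) * r := by
        calc (d + 1) * N * r = (d + 1) * r * N := by ring
          _ ≤ 2 * p ^ c * d * N := Nat.mul_le_mul_right _ hcond'
          _ = (N * p ^ c) * (2 * d) := by ring
          _ = k₀ * (2 * d) * r := by rw [← h2]; ring
      refine (Nat.le_of_mul_le_mul_right h3 hr0).trans_lt ?_
      exact Nat.mul_lt_mul_of_pos_right (by omega) (by omega)
  have hfl : ⌊((d + 1 : ℕ) : ℚ) * N / (2 * (((d + 1 : ℕ) : ℚ) - 1))⌋ < ((min κ k₀ + 2 : ℕ) : ℤ) := by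
    rw [Int.floor_lt]
    have hd' : (0 : ℚ) < d := by exact_mod_cast hd0
    push_cast
    rw [add_sub_cancel_right, div_lt_iff₀ (by linarith)]
    have : (((d + 1) * N : ℕ) : ℚ) < ((min κ k₀ + 2) * (2 * d) : ℕ) := by exact_mod_cast hmain
    push_cast at this
    exact this
  omega

end Main
theorem theorem7 {F : Type*} [Field F] [Fintype F] [DecidableEq F] (q p r : ℕ)
    (hq : Fintype.card F = q) (hp : p.Prime) (hr : r ∣ q - 1)
    (hpq : p ∣ q - 1) (hpr : ¬ p ∣ (q - 1) / r) :
    -- infinitely many lengths, and at least one admissible constant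
    (∀ b : ℕ, 2 ≤ b → codeLength p b q < codeLength p (b + 1) q) ∧
    (∃ lam : F, orderOf lam = r) ∧
    ∀ b n : ℕ, 2 ≤ b → n = codeLength p b q →
      (n : ℤ) = (cyclotomic (p ^ b) ℤ).eval (q : ℤ) ∧
      cosetSizes q n r = {p, p ^ b} ∧
      numCosets q n r p = 1 ∧
      (numCosets q n r (p ^ b) : ℚ) = ((n : ℚ) - p) / (p : ℚ) ^ b ∧
      ∀ lam : F, orderOf lam = r →
        (∃ β : AlgebraicClosure F, IsPrimitiveRoot β (n * r) ∧ algebraMap F _ lam = β ^ n) ∧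
        ∀ β : AlgebraicClosure F, IsPrimitiveRoot β (n * r) → algebraMap F _ lam = β ^ n →
          (∃ C : Submodule F (Fin n → F), IsConstacyclic lam C ∧
            HasDefiningSet lam r β C (ceilHalf q n r) ∧
            (Module.finrank F C : ℤ) =
              (n : ℤ) - p - (p : ℤ) ^ b * ⌈((n : ℚ) - p) / (2 * (p : ℚ) ^ b)⌉ ∧
            ⌈(q : ℚ) * (⌈((n : ℚ) - p) / (2 * (p : ℚ) ^ b)⌉ : ℚ) / ((q : ℚ) - 1)⌉ +
                lambdaTerm q (p ^ b) ((q ^ p ^ (b - 1) - 1) / r) r (numCosets q n r (p ^ b))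
              ≤ (minDistance C : ℤ)) ∧
          (r ≤ 3 ∨ q * r ≤ 2 * p ^ (b - 1) * (q - 1) →
            ∃ C : Submodule F (Fin n → F), IsConstacyclic lam C ∧
              HasDefiningSet lam r β C (floorHalf q n r) ∧
              (Module.finrank F C : ℤ) =
                (n : ℤ) - (p : ℤ) ^ b * ⌊((n : ℚ) - p) / (2 * (p : ℚ) ^ b)⌋ ∧
              ⌊(q : ℚ) * ((n : ℚ) - p) / (2 * (p : ℚ) ^ b * ((q : ℚ) - 1))⌋
                ≤ (minDistance C : ℤ)) := by
  have hq2 : 2 ≤ q := hq ▸ Fintype.one_lt_card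
  have hr0 : 0 < r := Nat.pos_of_dvd_of_pos hr (by omega)
  refine ⟨fun b hb => ?_, exists_orderOf_eq_of_dvd (hq.symm ▸ hr), fun b n hb hn => ?_⟩
  · obtain ⟨c, rfl⟩ : ∃ c, b = c + 1 := ⟨b - 1, by omega⟩
    exact codeLength_lt_succ hp hq2
  obtain ⟨c, rfl⟩ : ∃ c, b = c + 1 := ⟨b - 1, by omega⟩
  rw [Nat.add_sub_cancel]
  have hc : 1 ≤ c := by omega
  obtain ⟨hsz, hN1, hNn, hN2⟩ := coset_counts hp hq2 hr0 hr hpq hpr hc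
  have hm := pow_modEq_one_codeLength_mul (c := c) hp hq2 hr
  have hn0 := codeLength_succ_pos (c := c) hp hq2
  rw [← hn] at hsz hN1 hNn hm hn0
  have hpc : (p : ℚ) ^ (c + 1) ≠ 0 := pow_ne_zero _ (Nat.cast_ne_zero.2 hp.ne_zero)
  have hNq : ((n : ℚ) - p) = numCosets q n r (p ^ (c + 1)) * (p : ℚ) ^ (c + 1) := by
    have : ((numCosets q n r (p ^ (c + 1)) * p ^ (c + 1) + p : ℕ) : ℚ) = n := by rw [hNn]
    rw [← this]
    push_cast
    ring
  have hhalf : ((n : ℚ) - p) / (2 * (p : ℚ) ^ (c + 1)) =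
      (numCosets q n r (p ^ (c + 1)) : ℚ) / 2 := by
    rw [hNq]
    field_simp
  refine ⟨hn ▸ codeLength_succ_eq_eval hp hq2, hsz, hN1, ?_, fun lam hlam => ⟨?_, ?_⟩⟩
  · rw [hNq, mul_div_cancel_right₀ _ hpc]
  · refine exists_isPrimitiveRoot_pow_eq ?_ (Nat.mul_pos hn0 hr0) hlam
    rw [hq]
    have : (q ^ p ^ (c + 1)).Coprime (n * r) := coprime_of_modEq_one hm
    exact Nat.Coprime.coprime_dvd_left (dvd_pow_self q (pow_pos hp.pos _).ne') this
  · intro β hβ hlamβ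
    refine ⟨?_, fun hcond => ?_⟩
    · obtain ⟨C, h1, h2, h3, h4⟩ := exists_code_ceilHalf hq hp hr0 hr hpq hpr hc hn rfl hβ hlamβ
      refine ⟨C, h1, h2, ?_, ?_⟩
      · rw [hhalf, ceil_half]
        zify at h3
        push_cast
        linarith
      · rw [hhalf]; exact h4
    · obtain ⟨C, h1, h2, h3, h4⟩ :=
        exists_code_floorHalf hq hp hr0 hr hpq hpr hc hn rfl hcond hβ hlamβ
      refine ⟨C, h1, h2, ?_, ?_⟩
      · rw [hhalf, floor_half]
        zify at h3
        push_cast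
        linarith
      · have : (q : ℚ) * ((n : ℚ) - p) / (2 * (p : ℚ) ^ (c + 1) * ((q : ℚ) - 1)) =
            (q : ℚ) * numCosets q n r (p ^ (c + 1)) / (2 * ((q : ℚ) - 1)) := by
          rw [hNq, show (2 * (p : ℚ) ^ (c + 1) * ((q : ℚ) - 1)) =
            (2 * ((q : ℚ) - 1)) * (p : ℚ) ^ (c + 1) by ring, ← mul_assoc,
            mul_div_mul_right _ _ hpc]
        rw [this]; exact h4
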